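/- **Setting.** Let $d\in\{2,3\}$ and $m\in\{d-1,d\}$, and let $\Omega\subset\mathbb R^d$ and $B\subset\mathbb R^m$ (the reference body) be polyhedral domains with finite conforming simplicial meshes $\mathcal T$ and $\mathcal S$ of mesh sizes (largest element diameters) $h_x$ and $h_s$. The meshes are shape regular and quasi-uniform with constant $\sigma>0$: every element of $\mathcal T$ (resp. $\mathcal S$) contains a ball of radius $h_x/\sigma$ (resp. $h_s/\sigma$). Let $V_h\subset H^1_0(\Omega)^d$ be a space of continuous vector fields that are polynomials of degree at most $k$ on each element of $\mathcal T$, let $Q_h\subset L^2_0(\Omega)$ be a subspace, and let $S_h$ be the set of continuous maps $B\to\overline\Omega$ that are affine on each element of $\mathcal S$. For $Y\in S_h$ and $v\in V_h$ let $v[Y]$ denote the evaluation of $v$ along the structure, that is, the continuous, piecewise affine function on $\mathcal S$ with the values $v(Y(s_i))$ at the vertices $s_i$ of $\mathcal S$. Let $\rho_f,\nu,\Delta t>0$, $\delta\rho\ge0$, let $W$ be a $C^1$ convex energy density on $\mathbb R^{d\times m}$, $\mathbb P=\partial W/\partial\mathbb F$, $E(Y)=\int_B W(\nabla_sY)\,ds$,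 and write $\nabla_{\rm sym}u=\nabla u+(\nabla u)^\top$; $(\cdot,\cdot)$ and $\|\cdot\|_0$ refer to $L^2(\Omega)$, $\|\cdot\|_{0,B}$ to $L^2(B)$. **Scheme.** Let $u^n\in V_h$ $(0\le n\le N)$, $p^n\in Q_h$ $(1\le n\le N)$ and $X^n\in S_h$ $(-1\le n\le N)$ satisfy, for $0\le n<N$ and all $v\in V_h$, $q\in Q_h$, $$\begin{aligned} &\rho_f\Big(\Big(\tfrac{u^{n+1}-u^n}{\Delta t},v\Big)+\tfrac12\big((u^n\cdot\nabla u^{n+1},v)-(u^n\cdot\nabla v,u^{n+1})\big)\Big)+\nu(\nabla_{\rm sym}u^{n+1},\nabla_{\rm sym}v)-(\operatorname{div}v,p^{n+1})\\ &\quad=-\delta\rho\int_B\frac{u^{n+1}[X^n]-u^n[X^{n-1}]}{\Delta t}\cdot v[X^n]\,ds-\int_B\mathbb P(\nabla_sX^n):\nabla_s\big(v[X^n]\big)\,ds,\\ &(\operatorname{div}u^{n+1},q)=0, \end{aligned}$$ and, at all vertices $s_i$ of $\mathcal S$ and for $0\le n<N$, $\big(X^{n+1}(s_i)-X^n(s_i)\big)/\Delta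 t=u^{n+1}(X^n(s_i))$; the starting positions are consistent with the initial velocity, $\big(X^0(s_i)-X^{-1}(s_i)\big)/\Delta t=u^0(X^{-1}(s_i))$. Let $L^n$ be the maximum of $|X^n(s_i)-X^n(s_j)|$ over pairs of vertices $s_i,s_j$ of one element of $\mathcal S$, and let $C_e^n$ be the maximum, over the elements $K$ of $\mathcal T$, of the number of elements $T_k$ of $\mathcal S$ with $X^n(T_k)\cap K\ne\emptyset$. Let $\kappa_{max}\ge 0$ be a Lipschitz constant of $\mathbb P$ (in the Frobenius norm) on a convex set of tensors that contains the values of all the deformation gradients $\nabla_sX^n$, $0\le n\le N$. **Claim.** There is a constant $C>0$, depending only on $d$, $m$, $k$ and $\sigma$, such that for every such solution and every $0\le n<N$, with $$\nu_a=-\kappa_{max}\,C\,h_s^{m-2}\,h_x^{-(d-1)}\,\Delta t\,L^nC_e^n ,$$ the following hold. 1. The energy estimate $$\begin{aligned} &\frac{\rho_f}{2\Delta t}\big(\|u^{n+1}\|_0^2-\|u^n\|_0^2\big)+(\nu+\nu_a)\|\nabla u^{n+1}\|_0^2+\frac1{\Delta t}\big(E(X^{n+1})-E(X^n)\big)\\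 &\quad+\frac{\delta\rho}{2\Delta t}\Big(\Big\|\frac{X^{n+1}-X^n}{\Delta t}\Big\|_{0,B}^2-\Big\|\frac{X^n-X^{n-1}}{\Delta t}\Big\|_{0,B}^2\Big)\le0 . \end{aligned}$$ 2. Stability under a CFL condition: if $L^n\Delta t\le c\,h_x^{d-1}h_s^{2-m}$ for some $c$ with $\kappa_{max}\,C\,C_e^n\,c\le\nu$ (that is, $L^n\Delta t\le c\,h_xh_s$ for $(d,m)=(2,1)$, $c\,h_x$ for $(2,2)$, $c\,h_x^2$ for $(3,2)$, $c\,h_x^2/h_s$ for $(3,3)$), then the total energy $$\frac{\rho_f}2\|u^{n}\|_0^2+\frac{\delta\rho}2\Big\|\frac{X^{n}-X^{n-1}}{\Delta t}\Big\|_{0,B}^2+E(X^n)$$ at time level $n+1$ is at most the total energy at time level $n$. -/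

import Mathlib

open MeasureTheory Set

noncomputable section

namespace FEIBM

/-- The Euclidean space `ℝ^n`. -/
abbrev Vec (n : ℕ) : Type := EuclideanSpace ℝ (Fin n)

/-- Second order tensors (`d × m` matrices) with the Frobenius inner product `A : B`. -/
abbrev Tensor (d m : ℕ) : Type := EuclideanSpace ℝ (Fin d × Fin m)

/-- Simplicial meshes: geometric simplicial complexes. -/
abbrev Mesh (n : ℕ) : Type := Geometry.SimplicialComplex ℝ (Vec n)

section Meshes

variable {n : ℕ}

/-- The elements of a mesh in `ℝ^n`: its `n`-dimensional simplices, given by their vertices. -/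
def elements (T : Mesh n) : Set (Finset (Vec n)) :=
  {t | t ∈ T.faces ∧ t.card = n + 1}

/-- The closed simplex with vertex set `t`. -/
def cell (t : Finset (Vec n)) : Set (Vec n) := convexHull ℝ (t : Set (Vec n))

/-- The open polyhedral domain which is triangulated by `T`. -/
def domain (T : Mesh n) : Set (Vec n) := interior T.space

/-- The mesh size: the largest diameter of an element. -/
def meshSize (T : Mesh n) : ℝ :=
  sSup {r | ∃ t ∈ elements T, r = Metric.diam (cell t)}

/-- A finite mesh all of whose simplices are faces of elements, and which is
shape regular and quasi-uniform with constant `σ`: every element contains a ball of radius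
`h / σ`, where `h` is the mesh size. -/
structure IsQuasiUniform (σ : ℝ) (T : Mesh n) : Prop where
  finite : T.faces.Finite
  pure : ∀ t ∈ T.faces, ∃ s ∈ elements T, t ⊆ s
  inner_ball : ∀ t ∈ elements T, ∃ c, Metric.closedBall c (meshSize T / σ) ⊆ cell t

end Meshes

section Calculus

variable {d m : ℕ}

/-- The gradient `(∂_j Y_i)_{ij}` of a vector field `Y : ℝ^m → ℝ^d`. For the piecewise polynomial
fields below it is used under integrals only, and is classical in the interior of the elements. -/
def grad (Y : Vec m → Vec d) (s : Vec m) : Tensor d m :=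
  WithLp.toLp 2 fun p => fderiv ℝ Y s (EuclideanSpace.single p.2 1) p.1

/-- The symmetric gradient `∇u + (∇u)ᵀ`. -/
def symGrad (u : Vec d → Vec d) (x : Vec d) : Tensor d d :=
  WithLp.toLp 2 fun p => grad u x (p.1, p.2) + grad u x (p.2, p.1)

/-- The divergence. -/
def divergence (u : Vec d → Vec d) (x : Vec d) : ℝ := ∑ i, grad u x (i, i)

/-- The `L²(A)` inner product of two vector or tensor fields. -/
def ip {n : ℕ} {F : Type*} [NormedAddCommGroup F] [InnerProductSpace ℝ F]
    (A : Set (Vec n)) (f g : Vec n → F) : ℝ := ∫ x in A, inner ℝ (f x) (g x)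

/-- The squared `L²(A)` norm of a vector or tensor field. -/
def normSq {n : ℕ} {F : Type*} [NormedAddCommGroup F]
    (A : Set (Vec n)) (f : Vec n → F) : ℝ := ∫ x in A, ‖f x‖ ^ 2

/-- The convective derivative `a · ∇w`. -/
def convect (a w : Vec d → Vec d) (x : Vec d) : Vec d := fderiv ℝ w x (a x)

end Calculus

section Spaces

variable {d m : ℕ}

/-- `v` is a continuous vector field which vanishes on the boundary of the domain (and is extended
by zero), and is a polynomial of degree at most `k` on each element. -/
structure IsVelocityField (T : Mesh d) (k : ℕ) (v : Vec d → Vec d) : Prop where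
  continuous : Continuous v
  zero_off : ∀ x, x ∉ domain T → v x = 0
  poly : ∀ t ∈ elements T, ∃ p : Fin d → MvPolynomial (Fin d) ℝ,
    ∀ i, (p i).totalDegree ≤ k ∧ ∀ x ∈ cell t, v x i = MvPolynomial.eval (fun j => x j) (p i)

/-- A finite element velocity space in `H¹₀(Ω)^d`. -/
def IsVelocitySpace (T : Mesh d) (k : ℕ) (V : Submodule ℝ (Vec d → Vec d)) : Prop :=
  ∀ v ∈ V, IsVelocityField T k v

/-- `L²(Ω)`. -/
abbrev PressureL2 (T : Mesh d) : Type := Lp ℝ 2 (volume.restrict (domain T))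

/-- A pressure space in `L²₀(Ω)`, the square integrable functions of zero mean. -/
def IsPressureSpace (T : Mesh d) (Q : Submodule ℝ (PressureL2 T)) : Prop :=
  ∀ q ∈ Q, ∫ x in domain T, q x = 0

/-- The space `S_h` of the continuous maps from the reference body `S.space` to the closure of the
domain which are affine on each element of the solid mesh `S`. -/
structure IsPlacement (T : Mesh d) (S : Mesh m) (Y : Vec m → Vec d) : Prop where
  continuousOn : ContinuousOn Y S.space
  mapsTo : MapsTo Y S.space (closure (domain T))
  affine : ∀ t ∈ elements S, ∃ A : Vec m →ᵃ[ℝ] Vec d, EqOn Y A (cell t)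

/-- `w` are barycentric coordinates of `s` with respect to the face `t` of `S`. -/
def IsBarycentric (S : Mesh m) (s : Vec m) (t : Finset (Vec m)) (w : Vec m → ℝ) : Prop :=
  t ∈ S.faces ∧ (∀ a ∈ t, 0 ≤ w a) ∧ ∑ a ∈ t, w a = 1 ∧ ∑ a ∈ t, w a • a = s

open Classical in
/-- The continuous piecewise affine nodal interpolant of `g` on the solid mesh: at a point with
barycentric coordinates `w a` its value is `∑ w a • g a`. -/
def interp (S : Mesh m) (g : Vec m → Vec d) (s : Vec m) : Vec d :=
  if h : ∃ p : Finset (Vec m) × (Vec m → ℝ), IsBarycentric S s p.1 p.2 then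
    ∑ a ∈ h.choose.1, h.choose.2 a • g a
  else 0

/-- Evaluation of the field `v` along the structure in the placement `Y`: the composition
`v ∘ Y`, interpolated at the vertices of the solid mesh. -/
def along (S : Mesh m) (Y : Vec m → Vec d) (v : Vec d → Vec d) : Vec m → Vec d :=
  interp S fun s => v (Y s)

end Spaces

section Scheme

variable {d m : ℕ}

/-- The first Piola-Kirchhoff tensor `∂W/∂F` of the energy density `W`. -/
def piola (W : Tensor d m → ℝ) (F : Tensor d m) : Tensor d m := gradient W F

/-- The elastic energy `E(Y) = ∫_B W(∇Y)`. -/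
def elasticEnergy (S : Mesh m) (W : Tensor d m → ℝ) (Y : Vec m → Vec d) : ℝ :=
  ∫ s in S.space, W (grad Y s)

/-- The fluid-structure interaction force `⟨F_h, v⟩ = - ∫_B P(∇Y) : ∇ v(Y)`. -/
def force (S : Mesh m) (W : Tensor d m → ℝ) (Y : Vec m → Vec d) (v : Vec d → Vec d) : ℝ :=
  -ip S.space (fun s => piola W (grad Y s)) (grad (along S Y v))

/-- `(u, p, X)` solves `N` steps of size `τ` of the semi-implicit scheme. Velocities and pressures
are indexed by `0, …, N` (the pressure `p 0` is not used) and placements by `-1, 0, …, N`. -/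
structure IsSolution (T : Mesh d) (S : Mesh m) (V : Submodule ℝ (Vec d → Vec d))
    (Q : Submodule ℝ (PressureL2 T)) (W : Tensor d m → ℝ) (ρ δρ ν τ : ℝ) (N : ℕ)
    (u : ℕ → Vec d → Vec d) (p : ℕ → PressureL2 T) (X : ℤ → Vec m → Vec d) : Prop where
  velocity_mem : ∀ n ≤ N, u n ∈ V
  pressure_mem : ∀ n < N, p (n + 1) ∈ Q
  placement_mem : ∀ n : ℤ, -1 ≤ n → n ≤ N → IsPlacement T S (X n)
  momentum : ∀ n < N, ∀ v ∈ V,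
    ρ * (ip (domain T) (fun x => τ⁻¹ • (u (n + 1) x - u n x)) v
        + (ip (domain T) (convect (u n) (u (n + 1))) v
          - ip (domain T) (convect (u n) v) (u (n + 1))) / 2)
      + ν * ip (domain T) (symGrad (u (n + 1))) (symGrad v)
      - ∫ x in domain T, divergence v x * p (n + 1) x
    = -δρ * ip S.space
          (fun s => τ⁻¹ • (along S (X n) (u (n + 1)) s - along S (X (n - 1)) (u n) s))
          (along S (X n) v)
      + force S W (X n) v
  incompressible : ∀ n < N, ∀ q ∈ Q, ∫ x in domain T, divergence (u (n + 1)) x * q x = 0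
  /- The case `n = 0` says that the starting placements are consistent with the initial
  velocity, the case `n + 1` is the update of the placement in step `n`. -/
  motion : ∀ n ≤ N, ∀ a ∈ S.vertices, τ⁻¹ • (X n a - X (n - 1) a) = u n (X (n - 1) a)

/-- `L`: the largest distance between the images under `Y` of two vertices of one simplex of the
Lagrangian mesh. -/
def maxEdge (S : Mesh m) (Y : Vec m → Vec d) : ℝ :=
  sSup {r | ∃ t ∈ elements S, ∃ a ∈ t, ∃ b ∈ t, r = dist (Y a) (Y b)}

/-- `C_e`: the largest number of elements of the Lagrangian mesh whose images under `Y` touch one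
and the same element of the Eulerian mesh. -/
def maxTouching (T : Mesh d) (S : Mesh m) (Y : Vec m → Vec d) : ℕ :=
  sSup {j | ∃ K ∈ elements T,
    j = {t | t ∈ elements S ∧ (Y '' cell t ∩ cell K).Nonempty}.ncard}

/-- The artificial viscosity
`ν_a = -κ C h_s^(m-2) h_x^(-(d-1)) τ L C_e` for the placement `Y`. -/
def artificialViscosity (T : Mesh d) (S : Mesh m) (κ C τ : ℝ) (Y : Vec m → Vec d) : ℝ :=
  -κ * C * meshSize S ^ ((m : ℤ) - 2) * meshSize T ^ (-((d : ℤ) - 1)) * τ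
    * maxEdge S Y * maxTouching T S Y

/-- The squared `L²(B)` norm of the discrete velocity `(Y' - Y) / τ` of the structure. -/
def structureSpeedSq (S : Mesh m) (τ : ℝ) (Y Y' : Vec m → Vec d) : ℝ :=
  normSq S.space fun s => τ⁻¹ • (Y' s - Y s)

/-- The total energy at time level `n`. -/
def totalEnergy (T : Mesh d) (S : Mesh m) (W : Tensor d m → ℝ) (ρ δρ τ : ℝ)
    (u : ℕ → Vec d → Vec d) (X : ℤ → Vec m → Vec d) (n : ℕ) : ℝ :=
  ρ / 2 * normSq (domain T) (u n) + δρ / 2 * structureSpeedSq S τ (X (n - 1)) (X n)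
    + elasticEnergy S W (X n)

end Scheme

end FEIBM

end

/-!
The scheme is tested with its own solution: with `v = u (n + 1)` the convective terms cancel, the
pressure term vanishes by incompressibility, and the kinetic energies of the fluid and of the
structure are controlled by `(a - b) · a ≥ (|a|² - |b|²) / 2`
(`FEIBM.normSq_sub_normSq_le_ip`). The viscous term bounds `‖∇u‖²` by Korn's inequality
(`FEIBM.integral_norm_grad_sq_le_integral_norm_symGrad_sq`). As the structure is moved with the
interpolated velocity, `along S (X n) (u (n + 1))` is the difference quotient of the placements
(`FEIBM.along_eq`). The elastic force is evaluated at the old placement, so that by convexity of the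
energy density and by the Lipschitz bound on the Piola-Kirchhoff tensor its power accounts for the
change of the elastic energy up to the error `κ τ ∫_B |∇ u[X]|²`
(`FEIBM.elasticEnergy_sub_le`).

This error has to be absorbed by the viscosity, which is the content of
`FEIBM.exists_normSq_grad_along_le`. Two vertices of a solid element are at distance at most `L`
in the fluid domain. The velocity field is Lipschitz on each fluid element `K`, where an inverse
estimate for polynomials (`FEIBM.exists_sq_polyFun_le_integral`) bounds the constant `G_K` by
`G_K² ≤ C h_x⁻ᵈ ∫_K |∇u|²`. A segment stays in each fluid element for a length of at most `h_x`, so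
that the squared variation of the velocity along it is at most `L h_x ∑ G_K²`, summed over the
elements met by the segment (`FEIBM.IsVelocityField.norm_sub_sq_le`). The crossing of elements is
handled by `FEIBM.exists_weights_of_isClosed_cover`, which needs no differentiability and is
insensitive to segments running along faces. Each fluid element is touched by at most `C_e` solid
elements, whence the artificial viscosity.

Korn's inequality is proved without second derivatives: for compactly supported Lipschitz functions
`∫ ∂ᵢf ∂ⱼg = ∫ ∂ⱼf ∂ᵢg`, because the corresponding identity for difference quotients is the
translation invariance of the integral.
-/

noncomputable section

namespace FEIBM

/-! ### Piecewise Lipschitz functions on an interval -/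

/-- A function on `[a, b]` which is `G i`-Lipschitz on each of finitely many closed sets `F i`
covering `[a, b]` varies by at most `∑ G i * l i`, where the lengths `l i` do not exceed the
diameters of the `F i` and add up to at most `b - a`: from `a ∈ F i`, pass to the largest point of
`F i`, and go on from there with the other sets. -/
theorem exists_weights_of_isClosed_cover {ι M : Type*} [PseudoMetricSpace M]
    {f : ℝ → M} {F : ι → Set ℝ} {G D : ι → ℝ} (s : Finset ι) (hF : ∀ i ∈ s, IsClosed (F i))
    (hf : ∀ i ∈ s, ∀ x ∈ F i, ∀ y ∈ F i, dist (f x) (f y) ≤ G i * |x - y|)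
    (hD0 : ∀ i ∈ s, 0 ≤ D i) (hD : ∀ i ∈ s, ∀ x ∈ F i, ∀ y ∈ F i, |x - y| ≤ D i) {a b : ℝ}
    (hab : a ≤ b) (hcov : Icc a b ⊆ ⋃ i ∈ s, F i) :
    ∃ l : ι → ℝ, (∀ i ∈ s, 0 ≤ l i) ∧ (∀ i ∈ s, l i ≤ D i) ∧ ∑ i ∈ s, l i ≤ b - a ∧
      dist (f a) (f b) ≤ ∑ i ∈ s, G i * l i := by
  classical
  induction s using Finset.strongInduction generalizing a with
  | H s ih =>
    obtain ⟨i, his, hai⟩ : ∃ i ∈ s, a ∈ F i := by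
      simpa using hcov (left_mem_Icc.2 hab)
    have hK : IsCompact (F i ∩ Icc a b) := isCompact_Icc.inter_left (hF i his)
    have hne : (F i ∩ Icc a b).Nonempty := ⟨a, hai, left_mem_Icc.2 hab⟩
    obtain ⟨hcF, hca, hcb⟩ := hK.sSup_mem hne
    have hmax : ∀ x ∈ F i ∩ Icc a b, x ≤ sSup (F i ∩ Icc a b) := fun x hx =>
      le_csSup hK.bddAbove hx
    generalize sSup (F i ∩ Icc a b) = c at *
    have hstep : dist (f a) (f c) ≤ G i * (c - a) := by
      have := hf i his a hai c hcF
      rwa [abs_sub_comm, abs_of_nonneg (sub_nonneg.2 hca)] at this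
    have hlen : c - a ≤ D i := by
      have := hD i his a hai c hcF
      rwa [abs_sub_comm, abs_of_nonneg (sub_nonneg.2 hca)] at this
    rcases hcb.eq_or_lt with rfl | hcb
    · refine ⟨fun j => if j = i then c - a else 0, fun j _ => ?_, fun j hj => ?_, ?_, ?_⟩
      · dsimp only; split_ifs <;> linarith
      · dsimp only; split_ifs with h
        · exact h ▸ hlen
        · exact hD0 j hj
      · simp [his]
      · simpa [his] using hstep
    · have hcov' : Icc c b ⊆ ⋃ j ∈ s.erase i, F j := by
        rw [← closure_Ioc hcb.ne]
        refine closure_minimal ?_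
          (isClosed_biUnion_finset fun j hj => hF j (Finset.mem_of_mem_erase hj))
        intro x hx
        obtain ⟨j, hjs, hxj⟩ : ∃ j ∈ s, x ∈ F j := by
          simpa using hcov ⟨hca.trans hx.1.le, hx.2⟩
        have hji : j ≠ i := by
          rintro rfl
          exact absurd (hmax x ⟨hxj, hca.trans hx.1.le, hx.2⟩) (not_le.2 hx.1)
        simp only [mem_iUnion]
        exact ⟨j, Finset.mem_erase.2 ⟨hji, hjs⟩, hxj⟩
      obtain ⟨l, hl0, hlD, hls, hld⟩ := ih _ (Finset.erase_ssubset his)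
        (fun j hj => hF j (Finset.mem_of_mem_erase hj))
        (fun j hj => hf j (Finset.mem_of_mem_erase hj))
        (fun j hj => hD0 j (Finset.mem_of_mem_erase hj))
        (fun j hj => hD j (Finset.mem_of_mem_erase hj)) hcb.le hcov'
      have hne : ∀ j ∈ s.erase i, Function.update l i (c - a) j = l j := fun j hj =>
        Function.update_of_ne (Finset.ne_of_mem_erase hj) _ _
      refine ⟨Function.update l i (c - a), fun j hj => ?_, fun j hj => ?_, ?_, ?_⟩
      · rcases eq_or_ne j i with rfl | h
        · simpa using hca
        · simpa [Function.update_of_ne h] using hl0 j (Finset.mem_erase.2 ⟨h, hj⟩)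
      · rcases eq_or_ne j i with rfl | h
        · simpa using hlen
        · simpa [Function.update_of_ne h] using hlD j (Finset.mem_erase.2 ⟨h, hj⟩)
      · rw [← Finset.add_sum_erase _ _ his, Finset.sum_congr rfl hne, Function.update_self]
        linarith
      · rw [← Finset.add_sum_erase _ _ his,
          Finset.sum_congr rfl fun j hj => by rw [hne j hj], Function.update_self]
        exact (dist_triangle _ (f c) _).trans (add_le_add hstep hld)

/-! ### Korn's inequality -/

section Korn

open Filter Topology

variable {E : Type*} [NormedAddCommGroup E] [NormedSpace ℝ E] [MeasurableSpace E] [BorelSpace E]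
  {μ : Measure E} {f g : E → ℝ} {A B : NNReal}

theorem integrable_lineDeriv_mul_lineDeriv (hf : LipschitzWith A f) (hg : LipschitzWith B g)
    (hgc : HasCompactSupport g)
    [IsFiniteMeasureOnCompacts μ] (v w : E) :
    Integrable (fun x => lineDeriv ℝ f x v * lineDeriv ℝ g x w) μ := by
  have hsupp : Function.support (fun x => lineDeriv ℝ f x v * lineDeriv ℝ g x w) ⊆ tsupport g := by
    intro x hx
    by_contra hxg
    refine hx ?_
    have : g =ᶠ[𝓝 x] fun _ => 0 := notMem_tsupport_iff_eventuallyEq.1 hxg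
    have h0 : lineDeriv ℝ g x w = 0 := by rw [this.lineDeriv_eq]; simp [lineDeriv]
    simp [h0]
  rw [← integrableOn_iff_integrable_of_support_subset hsupp]
  refine Measure.integrableOn_of_bounded (M := (A * ‖v‖) * (B * ‖w‖))
    (IsCompact.measure_lt_top hgc).ne
    ((aestronglyMeasurable_lineDeriv hf.continuous μ).mul
      (aestronglyMeasurable_lineDeriv hg.continuous μ)) (Eventually.of_forall fun x => ?_)
  rw [norm_mul]
  exact mul_le_mul (norm_lineDeriv_le_of_lipschitz ℝ hf) (norm_lineDeriv_le_of_lipschitz ℝ hg)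
    (norm_nonneg _) (by positivity)

variable [FiniteDimensional ℝ E] [μ.IsAddHaarMeasure]

/-- The integral of the product of the derivatives of two Lipschitz functions is the limit of the
integrals of the products of the difference quotients. -/
theorem tendsto_integral_mul_differenceQuotient (hf : LipschitzWith A f) (hg : LipschitzWith B g)
    (hgc : HasCompactSupport g) (v w : E) :
    Tendsto (fun t : ℝ => ∫ x, (t⁻¹ • (f (x + t • v) - f x)) * (t⁻¹ • (g (x + t • w) - g x)) ∂μ)
      (𝓝[>] 0) (𝓝 (∫ x, lineDeriv ℝ f x v * lineDeriv ℝ g x w ∂μ)) := by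
  have hquot : ∀ {q : E → ℝ} {C : NNReal}, LipschitzWith C q → ∀ (z x : E) {t : ℝ}, 0 < t →
      ‖t⁻¹ • (q (x + t • z) - q x)‖ ≤ C * ‖z‖ := by
    intro q C hq z x t ht
    calc ‖t⁻¹ • (q (x + t • z) - q x)‖
        = t⁻¹ * ‖q (x + t • z) - q x‖ := by rw [norm_smul, norm_inv, Real.norm_of_nonneg ht.le]
      _ ≤ t⁻¹ * (C * ‖(x + t • z) - x‖) := by gcongr; exact hq.norm_sub_le _ _
      _ = C * ‖z‖ := by
        rw [add_sub_cancel_left, norm_smul, Real.norm_of_nonneg ht.le]; field_simp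
  let K := Metric.cthickening ‖w‖ (tsupport g)
  have hK : IsCompact K := IsCompact.cthickening hgc
  apply tendsto_integral_filter_of_dominated_convergence
      (K.indicator fun _ => (A * ‖v‖) * (B * ‖w‖))
  · have hfc := hf.continuous
    have hgc := hg.continuous
    exact Eventually.of_forall fun t => (by fun_prop : Continuous _).aestronglyMeasurable
  · filter_upwards [Ioc_mem_nhdsGT zero_lt_one] with t ht
    refine Eventually.of_forall fun x => ?_
    by_cases hx : x ∈ K
    · rw [indicator_of_mem hx, norm_mul]
      exact mul_le_mul (hquot hf v x ht.1) (hquot hg w x ht.1) (norm_nonneg _) (by positivity)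
    · have h0 : g x = 0 := by
        rw [← Function.notMem_support]
        contrapose hx
        exact Metric.self_subset_cthickening _ (subset_tsupport _ hx)
      have h1 : g (x + t • w) = 0 := by
        rw [← Function.notMem_support]
        contrapose hx
        apply Metric.mem_cthickening_of_dist_le _ _ ‖w‖ (tsupport g) (subset_tsupport _ hx)
        simp only [dist_eq_norm, sub_add_cancel_left, norm_neg, norm_smul, Real.norm_eq_abs,
          abs_of_nonneg ht.1.le]
        exact mul_le_of_le_one_left (norm_nonneg w) ht.2
      simp only [h0, h1, sub_self, smul_zero, mul_zero, norm_zero]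
      exact indicator_nonneg (fun _ _ => by positivity) _
  · rw [integrable_indicator_iff hK.measurableSet]
    exact continuousOn_const.integrableOn_compact hK
  · filter_upwards [hf.ae_lineDifferentiableAt v, hg.ae_lineDifferentiableAt w] with x hx hx'
    exact hx.hasLineDerivAt.tendsto_slope_zero_right.mul
      hx'.hasLineDerivAt.tendsto_slope_zero_right

/-- Two partial derivatives may be exchanged between the factors of an `L²` product: for the
difference quotients this is the translation invariance of the integral, and no second derivative
is needed. -/
theorem integral_lineDeriv_mul_lineDeriv_comm (hf : LipschitzWith A f) (hg : LipschitzWith B g)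
    (hgc : HasCompactSupport g) (v w : E) :
    ∫ x, lineDeriv ℝ f x v * lineDeriv ℝ g x w ∂μ
      = ∫ x, lineDeriv ℝ f x w * lineDeriv ℝ g x v ∂μ := by
  have h1 := tendsto_integral_mul_differenceQuotient (μ := μ) hf hg hgc v w
  have h2 := tendsto_integral_mul_differenceQuotient (μ := μ) hf hg hgc (-w) (-v)
  have h3 : ∫ x, lineDeriv ℝ f x w * lineDeriv ℝ g x v ∂μ
      = ∫ x, lineDeriv ℝ f x (-w) * lineDeriv ℝ g x (-v) ∂μ := by
    simp only [lineDeriv_neg, neg_mul_neg]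
  rw [h3]
  refine tendsto_nhds_unique h1 (h2.congr fun t => ?_)
  have hfi : ∀ z z' : E, Integrable (fun x => f (x + z) * g (x + z')) μ := fun z z' => by
    have c1 := hf.continuous
    have c2 := hg.continuous
    refine Continuous.integrable_of_hasCompactSupport (by fun_prop) ?_
    exact (hgc.comp_homeomorph (Homeomorph.addRight z')).mul_left
  have hexp : ∀ z z' : E, ∫ x, (t⁻¹ • (f (x + z) - f x)) * (t⁻¹ • (g (x + z') - g x)) ∂μ
      = (t⁻¹ * t⁻¹) * (∫ x, f (x + z) * g (x + z') ∂μ - ∫ x, f (x + z) * g x ∂μ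
          - ∫ x, f x * g (x + z') ∂μ + ∫ x, f x * g x ∂μ) := by
    intro z z'
    have i1 := hfi z z'
    have i2 := hfi z 0
    have i3 := hfi 0 z'
    have i4 := hfi 0 0
    simp only [add_zero] at i2 i3 i4
    rw [← integral_sub' i1 i2, ← integral_sub' (i1.sub i2) i3,
      ← integral_add' ((i1.sub i2).sub i3) i4, ← integral_const_mul]
    congr 1
    ext x
    simp only [smul_eq_mul, Pi.sub_apply, Pi.add_apply]
    ring
  rw [hexp, hexp]
  have e1 : ∫ x, f (x + t • v) * g (x + t • w) ∂μ = ∫ x, f (x + t • -w) * g (x + t • -v) ∂μ := by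
    rw [← integral_add_right_eq_self _ (t • (-v) + t • (-w))]
    congr 1
    ext x
    congr 2 <;> module
  have e2 : ∫ x, f (x + t • v) * g x ∂μ = ∫ x, f x * g (x + t • -v) ∂μ := by
    rw [← integral_add_right_eq_self _ (t • (-v))]
    simp
  have e3 : ∫ x, f x * g (x + t • w) ∂μ = ∫ x, f (x + t • -w) * g x ∂μ := by
    rw [← integral_add_right_eq_self _ (t • (-w))]
    simp
  rw [e1, e2, e3]
  ring

/-- Korn's inequality for compactly supported Lipschitz fields. Exchanging derivatives gives
`∫ ∇u : (∇u)ᵀ = ∫ (div u)²`, hence `∫ |∇u + (∇u)ᵀ|² = 2 ∫ |∇u|² + 2 ∫ (div u)²`. -/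
theorem integral_norm_grad_sq_le_integral_norm_symGrad_sq {d : ℕ} {u : Vec d → Vec d} {C : NNReal}
    (hu : LipschitzWith C u) (huc : HasCompactSupport u) :
    2 * ∫ x, ‖grad u x‖ ^ 2 ≤ ∫ x, ‖symGrad u x‖ ^ 2 := by
  let e : Fin d → Vec d := fun j => EuclideanSpace.single j 1
  let D : Fin d → Fin d → Vec d → ℝ := fun i j x => lineDeriv ℝ (fun y => u y i) x (e j)
  have hui : ∀ i, LipschitzWith C fun y => u y i := fun i =>
    LipschitzWith.of_dist_le_mul fun x y =>
      (PiLp.dist_apply_le (u x) (u y) i).trans (hu.dist_le_mul x y)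
  have huci : ∀ i, HasCompactSupport fun y => u y i := fun i =>
    huc.comp_left (g := fun z : Vec d => z i) (by simp)
  have hD : ∀ᵐ x, ∀ i j, grad u x (i, j) = D i j x := by
    filter_upwards [hu.ae_differentiableAt] with x hx i j
    have h1 : HasFDerivAt (fun y => u y i)
        ((EuclideanSpace.proj i : Vec d →L[ℝ] ℝ).comp (fderiv ℝ u x)) x :=
      (EuclideanSpace.proj i : Vec d →L[ℝ] ℝ).hasFDerivAt.comp x hx.hasFDerivAt
    exact ((h1.hasLineDerivAt (e j)).lineDeriv).symm
  have hint : ∀ i j k l, Integrable (fun x => D i j x * D k l x) := fun i j k l =>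
    integrable_lineDeriv_mul_lineDeriv (hui i) (hui k) (huci k) _ _
  have hcomm : ∀ i j, ∫ x, D i j x * D j i x = ∫ x, D i i x * D j j x := fun i j =>
    integral_lineDeriv_mul_lineDeriv_comm (hui i) (hui j) (huci j) _ _
  have h1 : ∫ x, ‖grad u x‖ ^ 2 = ∑ i, ∑ j, ∫ x, D i j x * D i j x := by
    simp_rw [← integral_finsetSum Finset.univ fun j _ => hint _ j _ j]
    rw [← integral_finsetSum Finset.univ fun i _ =>
      integrable_finsetSum Finset.univ fun j _ => hint i j i j]
    refine integral_congr_ae (hD.mono fun x hx => ?_)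
    simp only [EuclideanSpace.norm_sq_eq, Real.norm_eq_abs, sq_abs, Fintype.sum_prod_type, hx]
    simp only [sq]
  have h2 : ∫ x, ‖symGrad u x‖ ^ 2
      = ∑ i, ∑ j, (2 * ∫ x, D i j x * D i j x) + ∑ i, ∑ j, 2 * ∫ x, D i j x * D j i x := by
    have e1 : ∀ i j, Integrable fun x => 2 * (D i j x * D i j x) := fun i j =>
      (hint i j i j).const_mul 2
    have e2 : ∀ i j, Integrable fun x => 2 * (D i j x * D j i x) := fun i j =>
      (hint i j j i).const_mul 2
    simp_rw [← integral_const_mul]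
    simp_rw [← integral_finsetSum Finset.univ fun j _ => e1 _ j,
      ← integral_finsetSum Finset.univ fun j _ => e2 _ j]
    rw [← integral_finsetSum Finset.univ fun i _ =>
        integrable_finsetSum Finset.univ fun j _ => e1 i j,
      ← integral_finsetSum Finset.univ fun i _ =>
        integrable_finsetSum Finset.univ fun j _ => e2 i j,
      ← integral_add (integrable_finsetSum Finset.univ fun i _ =>
          integrable_finsetSum Finset.univ fun j _ => e1 i j)
        (integrable_finsetSum Finset.univ fun i _ =>
          integrable_finsetSum Finset.univ fun j _ => e2 i j)]
    refine integral_congr_ae (hD.mono fun x hx => ?_)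
    have hsym : ∑ i, ∑ j, D j i x * D j i x = ∑ i, ∑ j, D i j x * D i j x := Finset.sum_comm
    simp only [EuclideanSpace.norm_sq_eq, Real.norm_eq_abs, sq_abs, Fintype.sum_prod_type, symGrad,
      hx, add_sq]
    simp only [Finset.sum_add_distrib, ← Finset.mul_sum, sq, mul_assoc, hsym]
    ring
  have h3 : 0 ≤ ∑ i, ∑ j, ∫ x, D i j x * D j i x := by
    rw [Finset.sum_congr rfl fun i _ => (Finset.sum_congr rfl fun j _ => hcomm i j).trans
        (integral_finsetSum Finset.univ fun j _ => hint i i j j).symm,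
      ← integral_finsetSum Finset.univ fun i _ =>
        integrable_finsetSum Finset.univ fun j _ => hint i i j j]
    refine integral_nonneg fun x => ?_
    have : ∑ i, ∑ j, D i i x * D j j x = (∑ i, D i i x) ^ 2 := by
      rw [sq, Finset.sum_mul_sum]
    exact (sq_nonneg _).trans_eq this.symm
  rw [h1, h2]
  simp only [← Finset.mul_sum]
  linarith

end Korn

/-! ### Polynomials on balls -/

section Polynomials

open MvPolynomial

variable {d : ℕ}

/-- The polynomial function on `ℝ^d` given by `p`. -/
def polyFun (p : MvPolynomial (Fin d) ℝ) (x : Vec d) : ℝ := eval (fun j => x j) p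

theorem continuous_polyFun (p : MvPolynomial (Fin d) ℝ) : Continuous (polyFun p) := by
  unfold polyFun
  exact (MvPolynomial.continuous_eval p).comp (by fun_prop)

theorem hasFDerivAt_polyFun (p : MvPolynomial (Fin d) ℝ) (x : Vec d) :
    HasFDerivAt (polyFun p)
      (∑ j, polyFun (pderiv j p) x • (EuclideanSpace.proj j : Vec d →L[ℝ] ℝ)) x := by
  induction p using MvPolynomial.induction_on with
  | C a =>
    have h : polyFun (C a) = fun _ : Vec d => a := by ext; simp [polyFun]
    rw [h]
    simpa [polyFun] using hasFDerivAt_const a x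
  | add p q hp hq =>
    have h : polyFun (p + q) = polyFun p + polyFun q := by ext; simp [polyFun]
    rw [h]
    refine (hp.add hq).congr_fderiv ?_
    rw [← Finset.sum_add_distrib]
    exact Finset.sum_congr rfl fun j _ => by simp [polyFun, add_smul]
  | mul_X p i hp =>
    have h : polyFun (p * X i) = polyFun p * fun y : Vec d => y i := by ext; simp [polyFun]
    rw [h]
    refine (hp.mul (EuclideanSpace.proj i : Vec d →L[ℝ] ℝ).hasFDerivAt).congr_fderiv ?_
    ext y
    simp [polyFun, Pi.single_apply, add_mul, Finset.sum_add_distrib, Finset.mul_sum, mul_assoc,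
      apply_ite]

theorem totalDegree_pderiv_le (p : MvPolynomial (Fin d) ℝ) (j : Fin d) :
    (pderiv j p).totalDegree ≤ p.totalDegree := by
  refine Finset.sup_le fun s hs => ?_
  have h : s + Finsupp.single j 1 ∈ p.support := by
    rw [mem_support_iff] at hs ⊢
    rw [coeff_pderiv] at hs
    exact left_ne_zero_of_mul hs
  refine le_trans ?_ (le_totalDegree h)
  rw [Finsupp.sum_add_index' (by simp) (by simp)]
  exact Nat.le_add_right _ _

/-- The polynomials of bounded degree are invariant under translation and scaling. -/
theorem exists_polyFun_comp_affine (p : MvPolynomial (Fin d) ℝ) (c : Vec d) (h : ℝ) :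
    ∃ q : MvPolynomial (Fin d) ℝ, q.totalDegree ≤ p.totalDegree ∧
      ∀ x, polyFun q x = polyFun p (c + h • x) := by
  refine ⟨bind₁ (fun j => C (c j) + C h * X j) p, ?_, fun x => ?_⟩
  · rw [bind₁, aeval_def, eval₂_eq]
    refine totalDegree_finsetSum_le fun s hs => ?_
    refine (totalDegree_mul _ _).trans ?_
    rw [algebraMap_eq, totalDegree_C, zero_add]
    refine (totalDegree_finsetProd _ _).trans (le_trans ?_ (le_totalDegree hs))
    refine Finset.sum_le_sum fun j _ => (totalDegree_pow _ _).trans ?_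
    refine (Nat.mul_le_mul_left _ (?_ : _ ≤ 1)).trans (mul_one _).le
    refine (totalDegree_add _ _).trans (max_le (by simp) ((totalDegree_mul _ _).trans (by simp)))
  · simp only [polyFun, bind₁]
    rw [← MvPolynomial.coe_aeval_eq_eval, ← MvPolynomial.coe_aeval_eq_eval]
    simp only [RingHom.coe_coe]
    rw [← AlgHom.comp_apply, comp_aeval]
    simp

/-- A polynomial which vanishes almost everywhere on a ball vanishes on a box, hence is zero. -/
theorem eq_zero_of_integral_sq_eq_zero {P : Submodule ℝ (MvPolynomial (Fin d) ℝ)} {p : P} {r : ℝ}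
    (hr : 0 < r) (hp : ∫ x in Metric.closedBall (0 : Vec d) r,
      polyFun (p : MvPolynomial (Fin d) ℝ) x * polyFun (p : MvPolynomial (Fin d) ℝ) x = 0) :
    p = 0 := by
  have hc := continuous_polyFun (p : MvPolynomial (Fin d) ℝ)
  have hp' := (setIntegral_eq_zero_iff_of_nonneg_ae
    (Filter.Eventually.of_forall fun x => mul_self_nonneg _)
    ((hc.mul hc).continuousOn.integrableOn_compact (isCompact_closedBall _ _))).1 hp
  have h0 : EqOn (fun x => polyFun (p : MvPolynomial (Fin d) ℝ) x * polyFun p.1 x) 0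
      (Metric.ball (0 : Vec d) r) :=
    Measure.eqOn_open_of_ae_eq (ae_restrict_of_ae_restrict_of_subset Metric.ball_subset_closedBall
      hp') Metric.isOpen_ball (hc.mul hc).continuousOn continuousOn_const
  have hnhds : (fun y : Fin d → ℝ => (WithLp.toLp 2 y : Vec d)) ⁻¹' Metric.ball 0 r
      ∈ nhds (0 : Fin d → ℝ) :=
    (PiLp.continuous_toLp 2 fun _ : Fin d => ℝ).continuousAt.preimage_mem_nhds
      (Metric.ball_mem_nhds _ hr)
  obtain ⟨ε, hε, hball⟩ := Metric.mem_nhds_iff.1 hnhds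
  rw [ball_pi _ hε] at hball
  refine Subtype.ext (funext_set (fun _ => Metric.ball (0 : ℝ) ε) (fun _ => ?_) fun y hy => ?_)
  · rw [Real.ball_eq_Ioo]
    exact Set.Ioo_infinite (by linarith)
  · simpa [polyFun] using h0 (hball hy)

/-- A linear map on a finite-dimensional inner product space is bounded. The bound is stated without
the norm of that space, for use with an inner product which is not an instance. -/
theorem exists_norm_sq_le_inner {P F : Type*} [NormedAddCommGroup P] [InnerProductSpace ℝ P]
    [FiniteDimensional ℝ P] [NormedAddCommGroup F] [NormedSpace ℝ F] (L : P →ₗ[ℝ] F) :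
    ∃ C : ℝ, 0 ≤ C ∧ ∀ p, ‖L p‖ ^ 2 ≤ C * inner ℝ p p := by
  refine ⟨‖LinearMap.toContinuousLinearMap L‖ ^ 2, sq_nonneg _, fun p => ?_⟩
  rw [real_inner_self_eq_norm_sq, ← mul_pow]
  exact pow_le_pow_left₀ (norm_nonneg _) ((LinearMap.toContinuousLinearMap L).le_opNorm p) 2

/-- The supremum norm on the unit ball and the `L²` norm on the ball of radius `r` are equivalent on
the polynomials of degree at most `k`, as these form a finite-dimensional space. -/
theorem exists_sq_polyFun_le_integral_unit (d k : ℕ) {r : ℝ} (hr : 0 < r) :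
    ∃ C : ℝ, 0 ≤ C ∧ ∀ p : MvPolynomial (Fin d) ℝ, p.totalDegree ≤ k →
      ∀ x ∈ Metric.closedBall (0 : Vec d) 1,
        polyFun p x ^ 2 ≤ C * ∫ y in Metric.closedBall (0 : Vec d) r, polyFun p y ^ 2 := by
  let P := restrictTotalDegree (Fin d) ℝ k
  have hint : ∀ p q : MvPolynomial (Fin d) ℝ,
      IntegrableOn (fun x => polyFun p x * polyFun q x) (Metric.closedBall (0 : Vec d) r) :=
    fun p q => ((continuous_polyFun p).mul (continuous_polyFun q)).continuousOn.integrableOn_compact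
      (isCompact_closedBall _ _)
  -- The `L²` inner product on the ball of radius `r` makes `P` a Euclidean space, on which the
  -- restriction `L` to the unit ball, with the supremum norm there, is bounded.
  let core : InnerProductSpace.Core ℝ P :=
    { inner := fun p q => ∫ x in Metric.closedBall (0 : Vec d) r,
        polyFun (p : MvPolynomial (Fin d) ℝ) x * polyFun (q : MvPolynomial (Fin d) ℝ) x
      conj_inner_symm := fun p q => by simp [mul_comm]
      re_inner_nonneg := fun p => integral_nonneg fun x => mul_self_nonneg _
      add_left := fun p q s => by
        rw [← integral_add (hint _ _) (hint _ _)]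
        simp [polyFun, add_mul]
      smul_left := fun p q a => by
        simp [polyFun, mul_assoc, integral_const_mul, smul_eval]
      definite := fun p hp => eq_zero_of_integral_sq_eq_zero hr hp }
  let L : P →ₗ[ℝ] C(Metric.closedBall (0 : Vec d) 1, ℝ) :=
    { toFun := fun p => ⟨fun x => polyFun (p : MvPolynomial (Fin d) ℝ) x,
        (continuous_polyFun _).comp continuous_subtype_val⟩
      map_add' := fun p q => by ext; simp [polyFun]
      map_smul' := fun a p => by ext; simp [polyFun, smul_eval] }
  have : CompactSpace (Metric.closedBall (0 : Vec d) 1) :=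
    isCompact_iff_compactSpace.1 (isCompact_closedBall _ _)
  obtain ⟨C, hC, hL⟩ := @exists_norm_sq_le_inner P _ core.toNormedAddCommGroup
    (InnerProductSpace.ofCore core.toCore) _ _ _ L
  refine ⟨C, hC, fun p hp x hx => ?_⟩
  let p' : P := ⟨p, (mem_restrictTotalDegree _ _ _).2 hp⟩
  have h1 : ‖polyFun p x‖ ≤ ‖L p'‖ := (L p').norm_coe_le_norm ⟨x, hx⟩
  rw [← sq_abs, ← Real.norm_eq_abs]
  refine (pow_le_pow_left₀ (norm_nonneg _) h1 2).trans ((hL p').trans_eq ?_)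
  simp only [sq]
  rfl

/-- The inverse estimate for polynomials of degree at most `k`: on a ball of radius `h` they are
bounded by their `L²` norm on the concentric ball of radius `h / σ`. -/
theorem exists_sq_polyFun_le_integral (d k : ℕ) {σ : ℝ} (hσ : 0 < σ) :
    ∃ C : ℝ, 0 ≤ C ∧ ∀ p : MvPolynomial (Fin d) ℝ, p.totalDegree ≤ k →
      ∀ (c : Vec d) (h : ℝ), 0 < h → ∀ x ∈ Metric.closedBall c h,
        polyFun p x ^ 2
          ≤ C * (h ^ d)⁻¹ * ∫ y in Metric.closedBall c (h / σ), polyFun p y ^ 2 := by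
  obtain ⟨C, hC, hCp⟩ := exists_sq_polyFun_le_integral_unit d k (inv_pos.2 hσ)
  refine ⟨C, hC, fun p hp c h hh x hx => ?_⟩
  obtain ⟨q, hq, hqp⟩ := exists_polyFun_comp_affine p c h
  have h1 := hCp q (hq.trans hp) (h⁻¹ • (x - c)) (by
    rw [mem_closedBall_zero_iff, norm_smul, norm_inv, Real.norm_of_nonneg hh.le,
      inv_mul_le_iff₀ hh, mul_one]
    simpa [dist_eq_norm] using hx)
  simp only [hqp, smul_inv_smul₀ hh.ne', add_sub_cancel] at h1
  refine h1.trans_eq ?_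
  rw [mul_assoc]
  congr 1
  have h2 := Measure.setIntegral_comp_smul_of_pos (volume : Measure (Vec d))
    (fun y => polyFun p (c + y) ^ 2) (Metric.closedBall 0 σ⁻¹) hh
  rw [h2, finrank_euclideanSpace_fin, smul_eq_mul, smul_closedBall _ _ (by positivity)]
  congr 1
  have h3 := (measurePreserving_add_left (volume : Measure (Vec d)) c).setIntegral_preimage_emb
    (measurableEmbedding_addLeft c) (fun y => polyFun p y ^ 2) (Metric.closedBall c (h / σ))
  rw [← h3]
  congr 2
  ext y
  simp [dist_eq_norm, abs_of_pos hh, div_eq_mul_inv]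

end Polynomials

/-! ### Quasi-uniform meshes -/

section Mesh

variable {n : ℕ} {σ : ℝ} {T : Mesh n} {s t : Finset (Vec n)}

theorem convex_cell (t : Finset (Vec n)) : Convex ℝ (cell t) := convex_convexHull ℝ _

theorem isCompact_cell (t : Finset (Vec n)) : IsCompact (cell t) :=
  t.finite_toSet.isCompact_convexHull ℝ

theorem subset_cell (t : Finset (Vec n)) : (t : Set (Vec n)) ⊆ cell t := subset_convexHull ℝ _

theorem cell_subset_space (ht : t ∈ elements T) : cell t ⊆ T.space :=
  Geometry.SimplicialComplex.convexHull_subset_space ht.1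

theorem interior_cell_subset_domain (ht : t ∈ elements T) : interior (cell t) ⊆ domain T :=
  interior_mono (cell_subset_space ht)

theorem volume_cell_diff_interior (t : Finset (Vec n)) : volume (cell t \ interior (cell t)) = 0 :=
  measure_mono_null (sdiff_subset_sdiff_left subset_closure)
    ((convex_cell t).addHaar_frontier volume)

/-- Two elements meet in a common proper face, whose vertices do not span the space. -/
theorem disjoint_interior_cell (hs : s ∈ elements T) (ht : t ∈ elements T) (hst : s ≠ t) :
    Disjoint (interior (cell s)) (interior (cell t)) := by
  classical
  have hcard : (s ∩ t).card < n + 1 := by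
    rw [← hs.2]
    refine Finset.card_lt_card (Finset.ssubset_iff_subset_ne.2 ⟨Finset.inter_subset_left, ?_⟩)
    intro h
    exact hst (Finset.eq_of_subset_of_card_le (Finset.inter_eq_left.1 h) (by rw [hs.2, ht.2]))
  rw [Set.disjoint_iff_inter_eq_empty]
  by_contra hne
  have hne := nonempty_iff_ne_empty.2 hne
  rw [← interior_inter] at hne
  have hne' : (interior (convexHull ℝ ((s ∩ t : Finset (Vec n)) : Set (Vec n)))).Nonempty := by
    refine hne.mono (interior_mono ?_)
    rw [Finset.coe_inter]
    exact T.inter_subset_convexHull hs.1 ht.1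
  rw [interior_convexHull_nonempty_iff_affineSpan_eq_top] at hne'
  rcases Nat.eq_zero_or_pos (s ∩ t).card with h0 | hpos
  · rw [Finset.card_eq_zero] at h0
    rw [h0] at hne'
    simp at hne'
  have h1 := finrank_vectorSpan_image_finset_le ℝ (id : Vec n → Vec n) (s ∩ t)
    (n := (s ∩ t).card - 1) (by omega)
  rw [Finset.image_id, ← direction_affineSpan, hne', AffineSubspace.direction_top, finrank_top,
    finrank_euclideanSpace_fin] at h1
  omega

namespace IsQuasiUniform

variable (hT : IsQuasiUniform σ T)
include hT

theorem finite_elements : (elements T).Finite := hT.finite.subset fun _ h => h.1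

theorem space_eq : T.space = ⋃ t ∈ elements T, cell t := by
  refine subset_antisymm (fun x hx => ?_) (iUnion₂_subset fun t ht => cell_subset_space ht)
  obtain ⟨s, hs, hx⟩ := Geometry.SimplicialComplex.mem_space_iff.1 hx
  obtain ⟨t, ht, hst⟩ := hT.pure s hs
  exact mem_biUnion ht (convexHull_mono (Finset.coe_subset.2 hst) hx)

theorem isCompact_space : IsCompact T.space := by
  rw [hT.space_eq]
  exact hT.finite_elements.isCompact_biUnion fun t _ => isCompact_cell t

theorem bddAbove_diam : BddAbove {r | ∃ t ∈ elements T, r = Metric.diam (cell t)} := by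
  refine ((hT.finite_elements.image fun t => Metric.diam (cell t)).subset ?_).bddAbove
  rintro r ⟨t, ht, rfl⟩
  exact mem_image_of_mem _ ht

theorem dist_le_meshSize (ht : t ∈ elements T) {x y : Vec n} (hx : x ∈ cell t) (hy : y ∈ cell t) :
    dist x y ≤ meshSize T :=
  (Metric.dist_le_diam_of_mem (isCompact_cell t).isBounded hx hy).trans
    (le_csSup hT.bddAbove_diam ⟨t, ht, rfl⟩)

theorem meshSize_pos (hn : 0 < n) (ht : t ∈ elements T) : 0 < meshSize T := by
  have hcard : 1 < t.card := by rw [ht.2]; omega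
  obtain ⟨a, ha, b, hb, hab⟩ := Finset.one_lt_card.1 hcard
  exact (dist_pos.2 hab).trans_le (hT.dist_le_meshSize ht (subset_cell t ha) (subset_cell t hb))

theorem exists_inner_outer_ball (hσ : 0 < σ) (ht : t ∈ elements T) :
    ∃ c, Metric.closedBall c (meshSize T / σ) ⊆ cell t ∧
      cell t ⊆ Metric.closedBall c (meshSize T) := by
  obtain ⟨c, hc⟩ := hT.inner_ball t ht
  refine ⟨c, hc, fun x hx => hT.dist_le_meshSize ht hx (hc ?_)⟩
  have hne : (0 : ℝ) ≤ meshSize T := dist_nonneg.trans (hT.dist_le_meshSize ht hx hx)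
  exact Metric.mem_closedBall_self (by positivity)

theorem volume_real_interior_cell_le (hσ : 0 < σ) (ht : t ∈ elements T) :
    volume.real (interior (cell t))
      ≤ volume.real (Metric.closedBall (0 : Vec n) 1) * meshSize T ^ n := by
  obtain ⟨c, -, hc⟩ := hT.exists_inner_outer_ball hσ ht
  obtain ⟨a, ha⟩ : t.Nonempty := Finset.card_pos.1 (by rw [ht.2]; omega)
  have hne : (0 : ℝ) ≤ meshSize T :=
    dist_nonneg.trans (hT.dist_le_meshSize ht (subset_cell t ha) (subset_cell t ha))
  refine (measureReal_mono (interior_subset.trans hc)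
    (isCompact_closedBall c _).measure_lt_top.ne).trans_eq ?_
  rw [Measure.real, Measure.addHaar_closedBall' _ _ hne, finrank_euclideanSpace_fin,
    ENNReal.toReal_mul, ENNReal.toReal_ofReal (by positivity), mul_comm]
  rfl

/-- Both `T.space` and `domain T` agree up to a null set with the union of the open elements. -/
theorem ae_eq_interior_cells {A : Set (Vec n)} (hA : A ⊆ T.space)
    (hA' : ∀ t ∈ elements T, interior (cell t) ⊆ A) :
    A =ᵐ[volume] ⋃ t ∈ elements T, interior (cell t) := by
  refine Filter.EventuallyLE.antisymm ?_
    (Filter.Eventually.of_forall (iUnion₂_subset hA' : _ ⊆ A))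
  rw [ae_le_set]
  refine measure_mono_null (t := ⋃ t ∈ elements T, cell t \ interior (cell t)) ?_
    ((measure_biUnion_null_iff hT.finite_elements.countable).2 fun t _ =>
      volume_cell_diff_interior t)
  rintro x ⟨hxA, hx⟩
  obtain ⟨t, ht, hxt⟩ := mem_iUnion₂.1 (hT.space_eq ▸ hA hxA)
  exact mem_biUnion ht ⟨hxt, fun h => hx (mem_biUnion ht h)⟩

/-- The boundaries of the elements are null sets, so that integrals over the mesh are sums of
integrals over the interiors of the elements. -/
theorem setIntegral_eq_sum {A : Set (Vec n)} (hA : A ⊆ T.space)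
    (hA' : ∀ t ∈ elements T, interior (cell t) ⊆ A) {g : Vec n → ℝ}
    (hg : ∀ t ∈ elements T, IntegrableOn g (interior (cell t))) :
    ∫ x in A, g x = ∑ t ∈ hT.finite_elements.toFinset, ∫ x in interior (cell t), g x := by
  have h := hT.ae_eq_interior_cells hA hA'
  have hU : (⋃ t ∈ elements T, interior (cell t))
      = ⋃ t ∈ hT.finite_elements.toFinset, interior (cell t) := by simp
  rw [setIntegral_congr_set h, hU, integral_biUnion_finset _
    (fun t _ => isOpen_interior.measurableSet)]
  · intro s hs t ht hst
    exact disjoint_interior_cell (by simpa using hs) (by simpa using ht) hst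
  · intro t ht
    exact hg t (by simpa using ht)

theorem integral_eq_sum_of_eqOn {g : Vec n → ℝ} {a : Finset (Vec n) → ℝ}
    (hg : ∀ t ∈ elements T, ∀ x ∈ interior (cell t), g x = a t) :
    ∫ x in T.space, g x
      = ∑ t ∈ hT.finite_elements.toFinset, volume.real (interior (cell t)) * a t := by
  have hfin : ∀ t : Finset (Vec n), volume (interior (cell t)) ≠ ⊤ := fun t =>
    ((measure_mono interior_subset).trans_lt (isCompact_cell t).measure_lt_top).ne
  have hm : ∀ t : Finset (Vec n), MeasurableSet (interior (cell t)) := fun t =>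
    isOpen_interior.measurableSet
  rw [hT.setIntegral_eq_sum subset_rfl (fun t ht => interior_subset.trans (cell_subset_space ht))]
  · refine Finset.sum_congr rfl fun t ht => ?_
    rw [setIntegral_congr_fun (hm t) (hg t (by simpa using ht)), setIntegral_const, smul_eq_mul]
  · intro t ht
    exact (integrableOn_congr_fun (hg t ht) (hm t)).2 (integrableOn_const (hfin t))

theorem volume_space_diff_domain : volume (T.space \ domain T) = 0 := by
  have h := hT.ae_eq_interior_cells subset_rfl
    fun t ht => interior_subset.trans (cell_subset_space ht)
  refine measure_mono_null (sdiff_subset_sdiff_right ?_) (ae_le_set.1 h.le)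
  exact iUnion₂_subset fun t ht => interior_cell_subset_domain ht

end IsQuasiUniform

end Mesh

/-! ### Finite element velocities -/

section Gradient

variable {d m : ℕ}

/-- The operator norm is at most the Frobenius norm. -/
theorem norm_fderiv_le_norm_grad (Y : Vec m → Vec d) (s : Vec m) :
    ‖fderiv ℝ Y s‖ ≤ ‖grad Y s‖ := by
  refine ContinuousLinearMap.opNorm_le_bound _ (norm_nonneg _) fun y => ?_
  have hy : y = ∑ j, y j • EuclideanSpace.single j (1 : ℝ) := by
    ext i; simp [Pi.single_apply]
  have hcoord : ∀ i, fderiv ℝ Y s y i = ∑ j, y j * grad Y s (i, j) := by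
    intro i
    conv_lhs => rw [hy]
    simp [grad]
  refine abs_le_of_sq_le_sq' ?_ (by positivity) |>.2
  rw [mul_pow, EuclideanSpace.norm_sq_eq, EuclideanSpace.norm_sq_eq, EuclideanSpace.norm_sq_eq,
    Fintype.sum_prod_type, Finset.sum_mul]
  refine Finset.sum_le_sum fun i _ => ?_
  simp only [Real.norm_eq_abs, sq_abs, hcoord]
  rw [mul_comm]
  exact Finset.sum_mul_sq_le_sq_mul_sq _ _ _

theorem grad_congr {Y Z : Vec m → Vec d} {U : Set (Vec m)} (hU : IsOpen U) (h : EqOn Y Z U)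
    {s : Vec m} (hs : s ∈ U) : grad Y s = grad Z s := by
  unfold grad
  rw [(h.eventuallyEq_of_mem (hU.mem_nhds hs)).fderiv_eq]

/-- The vector field with the polynomial components `p i`. -/
def polyField (p : Fin d → MvPolynomial (Fin d) ℝ) (x : Vec d) : Vec d :=
  WithLp.toLp 2 fun i => polyFun (p i) x

theorem differentiable_polyField (p : Fin d → MvPolynomial (Fin d) ℝ) :
    Differentiable ℝ (polyField p) := fun x =>
  (differentiableAt_piLp 2).2 fun i => (hasFDerivAt_polyFun (p i) x).differentiableAt

theorem grad_polyField (p : Fin d → MvPolynomial (Fin d) ℝ) (x : Vec d) (i j : Fin d) :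
    grad (polyField p) x (i, j) = polyFun (MvPolynomial.pderiv j (p i)) x := by
  have h1 : HasFDerivAt (fun y => polyField p y i)
      ((EuclideanSpace.proj i : Vec d →L[ℝ] ℝ).comp (fderiv ℝ (polyField p) x)) x :=
    (EuclideanSpace.proj i : Vec d →L[ℝ] ℝ).hasFDerivAt.comp x
      (differentiable_polyField p x).hasFDerivAt
  have h2 := h1.unique (hasFDerivAt_polyFun (p i) x)
  have h3 := congrArg (fun L : Vec d →L[ℝ] ℝ => L (EuclideanSpace.single j 1)) h2
  simpa [grad, Pi.single_apply] using h3

theorem continuous_norm_sq_grad_polyField (p : Fin d → MvPolynomial (Fin d) ℝ) :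
    Continuous fun x => ‖grad (polyField p) x‖ ^ 2 := by
  simp only [EuclideanSpace.norm_sq_eq, Fintype.sum_prod_type, grad_polyField]
  exact continuous_finsetSum _ fun i _ => continuous_finsetSum _ fun j _ =>
    (continuous_polyFun _).norm.pow 2

end Gradient

namespace IsVelocityField

variable {d k : ℕ} {σ : ℝ} {T : Mesh d} {v : Vec d → Vec d}

theorem exists_polyField (hv : IsVelocityField T k v) {t : Finset (Vec d)} (ht : t ∈ elements T) :
    ∃ p : Fin d → MvPolynomial (Fin d) ℝ, (∀ i, (p i).totalDegree ≤ k) ∧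
      EqOn v (polyField p) (cell t) := by
  obtain ⟨p, hp⟩ := hv.poly t ht
  refine ⟨p, fun i => (hp i).1, fun x hx => ?_⟩
  ext i
  exact (hp i).2 x hx

theorem integrableOn_norm_sq_grad (hv : IsVelocityField T k v) {t : Finset (Vec d)}
    (ht : t ∈ elements T) : IntegrableOn (fun x => ‖grad v x‖ ^ 2) (interior (cell t)) := by
  obtain ⟨p, -, hp⟩ := hv.exists_polyField ht
  refine (integrableOn_congr_fun (fun x hx => ?_) isOpen_interior.measurableSet).2
    (((continuous_norm_sq_grad_polyField p).continuousOn.integrableOn_compact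
      (isCompact_cell t)).mono_set interior_subset)
  simp only [grad_congr isOpen_interior (hp.mono interior_subset) hx]

/-- The total square of the gradient over the domain is the sum over the elements. -/
theorem normSq_grad_eq_sum (hT : IsQuasiUniform σ T) (hv : IsVelocityField T k v) :
    normSq (domain T) (grad v)
      = ∑ t ∈ hT.finite_elements.toFinset, normSq (interior (cell t)) (grad v) :=
  hT.setIntegral_eq_sum interior_subset (fun _ ht => interior_cell_subset_domain ht)
    fun _ ht => hv.integrableOn_norm_sq_grad ht

end IsVelocityField

/-- The local inverse estimate: on each element a finite element velocity is Lipschitz, with a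
constant which is controlled by the `L²` norm of its gradient on that element. -/
theorem exists_norm_sub_le_on_cell (d k : ℕ) (hd : 0 < d) {σ : ℝ} (hσ : 0 < σ) :
    ∃ C : ℝ, 0 ≤ C ∧ ∀ (T : Mesh d) (v : Vec d → Vec d), IsQuasiUniform σ T →
      IsVelocityField T k v → ∀ t ∈ elements T, ∀ x ∈ cell t, ∀ y ∈ cell t,
        ‖v x - v y‖ ≤ √(C * (meshSize T ^ d)⁻¹ * normSq (interior (cell t)) (grad v))
          * ‖x - y‖ := by
  obtain ⟨C, hC, hinv⟩ := exists_sq_polyFun_le_integral d k hσ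
  refine ⟨C, hC, fun T v hT hv t ht x hx y hy => ?_⟩
  obtain ⟨p, hpk, hp⟩ := hv.exists_polyField ht
  obtain ⟨c, hc, hc'⟩ := hT.exists_inner_outer_ball hσ ht
  have hh := hT.meshSize_pos hd ht
  have hcont := continuous_norm_sq_grad_polyField p
  have hball : ∫ z in Metric.closedBall c (meshSize T / σ), ‖grad (polyField p) z‖ ^ 2
      ≤ normSq (interior (cell t)) (grad v) := by
    calc _ ≤ ∫ z in cell t, ‖grad (polyField p) z‖ ^ 2 :=
          setIntegral_mono_set (hcont.continuousOn.integrableOn_compact (isCompact_cell t))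
            (Filter.Eventually.of_forall fun _ => sq_nonneg _)
            (Filter.Eventually.of_forall hc)
      _ = ∫ z in interior (cell t), ‖grad (polyField p) z‖ ^ 2 := by
          refine setIntegral_congr_set (Filter.EventuallyLE.antisymm ?_
            (Filter.Eventually.of_forall interior_subset))
          rw [ae_le_set]
          exact volume_cell_diff_interior t
      _ = _ := by
          refine setIntegral_congr_fun isOpen_interior.measurableSet fun z hz => ?_
          simp only [grad_congr isOpen_interior (hp.mono interior_subset) hz]
  have hgrad : ∀ z ∈ cell t, ‖fderiv ℝ (polyField p) z‖
      ≤ √(C * (meshSize T ^ d)⁻¹ * normSq (interior (cell t)) (grad v)) := by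
    intro z hz
    refine (norm_fderiv_le_norm_grad _ _).trans (Real.le_sqrt_of_sq_le ?_)
    refine le_trans ?_ (mul_le_mul_of_nonneg_left hball (by positivity))
    have hexp : ∀ z, ‖grad (polyField p) z‖ ^ 2
        = ∑ i, ∑ j, polyFun (MvPolynomial.pderiv j (p i)) z ^ 2 := fun z => by
      simp only [EuclideanSpace.norm_sq_eq, Fintype.sum_prod_type, grad_polyField,
        Real.norm_eq_abs, sq_abs]
    have hint : ∀ i j, IntegrableOn (fun z => polyFun (MvPolynomial.pderiv j (p i)) z ^ 2)
        (Metric.closedBall c (meshSize T / σ)) := fun i j =>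
      ((continuous_polyFun _).pow 2).continuousOn.integrableOn_compact (isCompact_closedBall _ _)
    simp only [hexp]
    rw [integral_finsetSum _ fun i _ => integrable_finsetSum _ fun j _ => hint i j,
      Finset.mul_sum]
    refine Finset.sum_le_sum fun i _ => ?_
    rw [integral_finsetSum _ fun j _ => hint i j, Finset.mul_sum]
    exact Finset.sum_le_sum fun j _ =>
      hinv _ ((totalDegree_pderiv_le _ _).trans (hpk i)) c _ hh z (hc' hz)
  rw [hp hx, hp hy]
  exact (convex_cell t).norm_image_sub_le_of_norm_fderiv_le
    (fun z _ => differentiable_polyField p z) hgrad hy hx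

namespace IsVelocityField

variable {d k : ℕ} {σ : ℝ} {T : Mesh d} {v : Vec d → Vec d}

/-- The variation of a velocity field along a segment is distributed among the elements in the
set `s` of those which the segment meets; outside of the domain the field vanishes. -/
theorem exists_weights (hT : IsQuasiUniform σ T) (hv : IsVelocityField T k v)
    {G : Finset (Vec d) → ℝ}
    (hG : ∀ t ∈ elements T, ∀ x ∈ cell t, ∀ y ∈ cell t, ‖v x - v y‖ ≤ G t * ‖x - y‖)
    {s : Finset (Finset (Vec d))} (hs : ∀ t ∈ s, t ∈ elements T) {y z : Vec d}
    (hyz : ∀ t ∈ elements T, (segment ℝ y z ∩ cell t).Nonempty → t ∈ s) :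
    ∃ l : Finset (Vec d) → ℝ, (∀ t ∈ s, 0 ≤ l t) ∧ (∀ t ∈ s, l t ≤ meshSize T) ∧
      ∑ t ∈ s, l t ≤ ‖y - z‖ ∧ ‖v y - v z‖ ≤ ∑ t ∈ s, G t * l t := by
  have hh : ∀ t ∈ s, 0 ≤ meshSize T := fun t ht => by
    obtain ⟨a, ha⟩ : t.Nonempty := Finset.card_pos.1 (by rw [(hs t ht).2]; omega)
    exact dist_nonneg.trans (hT.dist_le_meshSize (hs t ht) (subset_cell t ha) (subset_cell t ha))
  rcases eq_or_ne y z with rfl | hne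
  · exact ⟨0, fun _ _ => le_rfl, hh, by simp, by simp⟩
  have hL : 0 < ‖y - z‖ := norm_pos_iff.2 (sub_ne_zero.2 hne)
  let γ : ℝ → Vec d := fun r => y + r • (z - y)
  have hγc : Continuous γ := by fun_prop
  have hγ : ∀ r r', ‖γ r - γ r'‖ = |r - r'| * ‖y - z‖ := fun r r' => by
    have : γ r - γ r' = (r - r') • (z - y) := by simp only [γ]; module
    rw [this, norm_smul, Real.norm_eq_abs, norm_sub_rev]
  let F : Option (Finset (Vec d)) → Set ℝ := fun o =>
    Icc 0 1 ∩ γ ⁻¹' (o.elim (domain T)ᶜ cell)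
  let G' : Option (Finset (Vec d)) → ℝ := fun o => o.elim 0 fun t => G t * ‖y - z‖
  let D : Option (Finset (Vec d)) → ℝ := fun o => o.elim 1 fun _ => meshSize T / ‖y - z‖
  have hF : ∀ o ∈ Finset.insertNone s, IsClosed (F o) := by
    intro o ho
    refine isClosed_Icc.inter (IsClosed.preimage hγc ?_)
    cases o with
    | none => exact isOpen_interior.isClosed_compl
    | some t => exact (isCompact_cell t).isClosed
  have hvG : ∀ o ∈ Finset.insertNone s, ∀ r ∈ F o, ∀ r' ∈ F o,
      dist ((v ∘ γ) r) ((v ∘ γ) r') ≤ G' o * |r - r'| := by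
    rintro (_ | t) ho r hr r' hr'
    · simp [G', hv.zero_off _ hr.2, hv.zero_off _ hr'.2]
    · have := hG t (hs t (by simpa using ho)) _ hr.2 _ hr'.2
      rw [hγ] at this
      simp only [G', Function.comp_apply, dist_eq_norm, Option.elim_some]
      linarith
  have hD0 : ∀ o ∈ Finset.insertNone s, 0 ≤ D o := by
    rintro (_ | t) ho
    · simp [D]
    · exact div_nonneg (hh t (by simpa using ho)) hL.le
  have hD : ∀ o ∈ Finset.insertNone s, ∀ r ∈ F o, ∀ r' ∈ F o, |r - r'| ≤ D o := by
    rintro (_ | t) ho r hr r' hr'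
    · change |r - r'| ≤ 1
      have h1 := hr.1
      have h2 := hr'.1
      exact abs_sub_le_iff.2 ⟨by linarith [h1.2, h2.1], by linarith [h1.1, h2.2]⟩
    · have := hT.dist_le_meshSize (hs t (by simpa using ho)) hr.2 hr'.2
      rw [dist_eq_norm, hγ] at this
      simpa only [D, Option.elim_some, le_div_iff₀ hL] using this
  have hcov : Icc (0 : ℝ) 1 ⊆ ⋃ o ∈ Finset.insertNone s, F o := by
    intro r hr
    by_cases hdom : γ r ∈ domain T
    · obtain ⟨t, ht, hrt⟩ := mem_iUnion₂.1 (hT.space_eq ▸ interior_subset hdom)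
      have hts : t ∈ s := hyz t ht ⟨γ r, by
        rw [segment_eq_image']
        exact ⟨r, hr, rfl⟩, hrt⟩
      exact mem_iUnion₂.2 ⟨some t, by simpa using hts, hr, hrt⟩
    · exact mem_iUnion₂.2 ⟨none, by simp, hr, hdom⟩
  obtain ⟨l, hl0, hlD, hls, hld⟩ :=
    exists_weights_of_isClosed_cover _ hF hvG hD0 hD zero_le_one hcov
  have hsum : ∑ t ∈ s, l (some t) ≤ 1 := by
    rw [Finset.sum_insertNone] at hls
    have := hl0 none (by simp)
    linarith
  refine ⟨fun t => ‖y - z‖ * l (some t), fun t ht => ?_, fun t ht => ?_, ?_, ?_⟩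
  · exact mul_nonneg hL.le (hl0 _ (by simpa using ht))
  · have := hlD (some t) (by simpa using ht)
    simp only [D, Option.elim_some] at this
    rwa [le_div_iff₀ hL, mul_comm] at this
  · rw [← Finset.mul_sum]
    exact mul_le_of_le_one_right hL.le hsum
  · rw [Finset.sum_insertNone] at hld
    simpa [γ, G', dist_eq_norm, mul_assoc] using hld

/-- The variation of a velocity field along a segment in terms of the squares of its Lipschitz
constants on the elements: the Cauchy-Schwarz inequality is applied with the lengths for which the
segment is counted in the elements, each of them at most the mesh size. -/
theorem norm_sub_sq_le (hT : IsQuasiUniform σ T) (hv : IsVelocityField T k v)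
    {G : Finset (Vec d) → ℝ}
    (hG : ∀ t ∈ elements T, ∀ x ∈ cell t, ∀ y ∈ cell t, ‖v x - v y‖ ≤ G t * ‖x - y‖)
    {s : Finset (Finset (Vec d))} (hs : ∀ t ∈ s, t ∈ elements T) {y z : Vec d}
    (hyz : ∀ t ∈ elements T, (segment ℝ y z ∩ cell t).Nonempty → t ∈ s) :
    ‖v y - v z‖ ^ 2 ≤ ‖y - z‖ * (meshSize T * ∑ t ∈ s, G t ^ 2) := by
  obtain ⟨l, hl0, hlh, hls, hld⟩ := hv.exists_weights hT hG hs hyz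
  calc ‖v y - v z‖ ^ 2 ≤ (∑ t ∈ s, G t * l t) ^ 2 := pow_le_pow_left₀ (norm_nonneg _) hld 2
    _ ≤ (∑ t ∈ s, l t) * ∑ t ∈ s, l t * G t ^ 2 :=
      Finset.sum_sq_le_sum_mul_sum_of_sq_le_mul _ hl0
        (fun t ht => mul_nonneg (hl0 t ht) (sq_nonneg _)) fun t _ => le_of_eq (by ring)
    _ ≤ ‖y - z‖ * (meshSize T * ∑ t ∈ s, G t ^ 2) := by
      refine mul_le_mul hls ?_ (Finset.sum_nonneg fun t ht =>
        mul_nonneg (hl0 t ht) (sq_nonneg _)) (norm_nonneg _)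
      rw [Finset.mul_sum]
      exact Finset.sum_le_sum fun t ht => mul_le_mul_of_nonneg_right (hlh t ht) (sq_nonneg _)

theorem exists_lipschitzWith (hd : 0 < d) (hσ : 0 < σ) (hT : IsQuasiUniform σ T)
    (hv : IsVelocityField T k v) : ∃ C, LipschitzWith C v := by
  obtain ⟨C, -, hC⟩ := exists_norm_sub_le_on_cell d k hd hσ
  let G : Finset (Vec d) → ℝ := fun t =>
    √(C * (meshSize T ^ d)⁻¹ * normSq (interior (cell t)) (grad v))
  have hG0 : ∀ t, 0 ≤ G t := fun t => Real.sqrt_nonneg _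
  let s := hT.finite_elements.toFinset
  refine ⟨NNReal.mk (∑ t ∈ s, G t) (Finset.sum_nonneg fun t _ => hG0 t),
    LipschitzWith.of_dist_le_mul fun y z => ?_⟩
  obtain ⟨l, hl0, -, hls, hld⟩ := hv.exists_weights hT (G := G) (hC T v hT hv) (s := s)
    (fun t ht => by simpa [s] using ht) (y := y) (z := z) (fun t ht _ => by simpa [s] using ht)
  rw [dist_eq_norm, dist_eq_norm]
  refine hld.trans ?_
  rw [NNReal.coe_mk, Finset.sum_mul]
  exact Finset.sum_le_sum fun t ht => mul_le_mul_of_nonneg_left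
    ((Finset.single_le_sum hl0 ht).trans hls) (hG0 t)

theorem hasCompactSupport (hT : IsQuasiUniform σ T) (hv : IsVelocityField T k v) :
    HasCompactSupport v :=
  HasCompactSupport.intro hT.isCompact_space fun x hx =>
    hv.zero_off x fun h => hx (interior_subset h)

/-- Korn's inequality on the domain; the field is extended by zero. -/
theorem normSq_grad_le_normSq_symGrad (hd : 0 < d) (hσ : 0 < σ) (hT : IsQuasiUniform σ T)
    (hv : IsVelocityField T k v) :
    2 * normSq (domain T) (grad v) ≤ normSq (domain T) (symGrad v) := by
  obtain ⟨C, hC⟩ := hv.exists_lipschitzWith hd hσ hT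
  have hzero : ∀ᵐ x, x ∉ domain T → fderiv ℝ v x = 0 := by
    have h0 : ∀ᵐ x, x ∉ T.space \ domain T := measure_eq_zero_iff_ae_notMem.1
      hT.volume_space_diff_domain
    filter_upwards [h0] with x hx hxd
    have hxs : x ∈ T.spaceᶜ := fun h => hx ⟨h, hxd⟩
    have : EqOn v (fun _ => 0) T.spaceᶜ := fun y hy =>
      hv.zero_off y fun h => hy (interior_subset h)
    rw [(this.eventuallyEq_of_mem
      (hT.isCompact_space.isClosed.isOpen_compl.mem_nhds hxs)).fderiv_eq]
    simp
  have h1 : normSq (domain T) (grad v) = ∫ x, ‖grad v x‖ ^ 2 := by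
    refine setIntegral_eq_integral_of_ae_compl_eq_zero (hzero.mono fun x hx hxd => ?_)
    simp [EuclideanSpace.norm_sq_eq, grad, hx hxd]
  have h2 : normSq (domain T) (symGrad v) = ∫ x, ‖symGrad v x‖ ^ 2 := by
    refine setIntegral_eq_integral_of_ae_compl_eq_zero (hzero.mono fun x hx hxd => ?_)
    simp [EuclideanSpace.norm_sq_eq, symGrad, grad, hx hxd]
  rw [h1, h2]
  exact integral_norm_grad_sq_le_integral_norm_symGrad_sq hC (hv.hasCompactSupport hT)

end IsVelocityField

/-! ### Piecewise affine maps on the solid mesh -/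

section PiecewiseAffine

variable {d m : ℕ} {σ : ℝ} {S : Mesh m} {t : Finset (Vec m)}

theorem mem_vertices_of_mem_elements (ht : t ∈ elements S) {a : Vec m} (ha : a ∈ t) :
    a ∈ S.vertices :=
  S.down_closed ht.1 (Finset.singleton_subset_iff.2 ha) (Finset.singleton_nonempty a)

/-- A piecewise affine map is the interpolant of its vertex values. -/
theorem interp_eq (hS : IsQuasiUniform σ S) {Z g : Vec m → Vec d}
    (hZ : ∀ t ∈ elements S, ∃ A : Vec m →ᵃ[ℝ] Vec d, EqOn Z A (cell t))
    (hg : ∀ a ∈ S.vertices, g a = Z a) {s : Vec m} (hs : s ∈ S.space) :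
    interp S g s = Z s := by
  have hex : ∃ p : Finset (Vec m) × (Vec m → ℝ), IsBarycentric S s p.1 p.2 := by
    obtain ⟨t, ht, hst⟩ := Geometry.SimplicialComplex.mem_space_iff.1 hs
    obtain ⟨w, hw0, hw1, hws⟩ := Finset.mem_convexHull'.1 hst
    exact ⟨(t, w), ht, hw0, hw1, hws⟩
  rw [interp, dif_pos hex]
  obtain ⟨hf, hw0, hw1, hws⟩ := hex.choose_spec
  generalize hex.choose.1 = f at *
  generalize hex.choose.2 = w at *
  obtain ⟨t, ht, hft⟩ := hS.pure f hf
  obtain ⟨A, hA⟩ := hZ t ht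
  have hst : s ∈ cell t := convexHull_mono (Finset.coe_subset.2 hft)
    (Finset.mem_convexHull'.2 ⟨w, hw0, hw1, hws⟩)
  rw [hA hst, ← hws]
  have hdec : ∀ x, A x = A.linear x + A 0 := fun x => congrFun A.decomp x
  rw [hdec, map_sum]
  simp only [map_smul]
  have hval : ∀ a ∈ f, w a • g a = w a • A.linear a + w a • A 0 := fun a ha => by
    rw [hg a (mem_vertices_of_mem_elements ht (hft ha)), hA (subset_cell t (hft ha)), hdec a,
      smul_add]
  rw [Finset.sum_congr rfl hval, Finset.sum_add_distrib, ← Finset.sum_smul, hw1, one_smul]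

theorem hasFDerivAt_affineMap (A : Vec m →ᵃ[ℝ] Vec d) (s : Vec m) :
    HasFDerivAt A (LinearMap.toContinuousLinearMap A.linear) s := by
  have hdec : (A : Vec m → Vec d) = fun x => LinearMap.toContinuousLinearMap A.linear x + A 0 :=
    A.decomp
  rw [hdec]
  exact (LinearMap.toContinuousLinearMap A.linear).hasFDerivAt.add_const _

/-- The gradient of a piecewise affine map is piecewise constant. -/
theorem exists_grad_eq {Z : Vec m → Vec d}
    (hZ : ∀ t ∈ elements S, ∃ A : Vec m →ᵃ[ℝ] Vec d, EqOn Z A (cell t)) :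
    ∃ F : Finset (Vec m) → Tensor d m, ∀ t ∈ elements S, ∀ s ∈ interior (cell t),
      DifferentiableAt ℝ Z s ∧ grad Z s = F t := by
  choose! A hA using hZ
  refine ⟨fun t => grad (A t) 0, fun t ht s hs => ⟨?_, ?_⟩⟩
  · exact (hasFDerivAt_affineMap (A t) s).differentiableAt.congr_of_eventuallyEq
      (((hA t ht).mono interior_subset).eventuallyEq_of_mem (isOpen_interior.mem_nhds hs))
  · rw [grad_congr isOpen_interior ((hA t ht).mono interior_subset) hs]
    simp only [grad, (hasFDerivAt_affineMap (A t) _).fderiv]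

theorem grad_smul_sub {Y Z : Vec m → Vec d} {s : Vec m} (c : ℝ) (hY : DifferentiableAt ℝ Y s)
    (hZ : DifferentiableAt ℝ Z s) :
    grad (fun s => c • (Z s - Y s)) s = c • (grad Z s - grad Y s) := by
  have h : HasFDerivAt (fun s => c • (Z s - Y s)) (c • (fderiv ℝ Z s - fderiv ℝ Y s)) s :=
    (hZ.hasFDerivAt.sub hY.hasFDerivAt).const_smul c
  ext p
  simp [grad, h.fderiv]

/-- The image of a simplex under an affine map has the diameter of the image of its vertices. -/
theorem dist_le_of_mem_cell (A : Vec m →ᵃ[ℝ] Vec d) {M : ℝ} (hM : 0 ≤ M)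
    (hA : ∀ a ∈ t, ∀ b ∈ t, dist (A a) (A b) ≤ M) {x y : Vec m} (hx : x ∈ cell t)
    (hy : y ∈ cell t) : dist (A x) (A y) ≤ M := by
  have himg : A '' cell t = convexHull ℝ (A '' t) := AffineMap.image_convexHull A _
  have hx' : A x ∈ convexHull ℝ (A '' t) := himg ▸ mem_image_of_mem A hx
  have hy' : A y ∈ convexHull ℝ (A '' t) := himg ▸ mem_image_of_mem A hy
  refine (Metric.dist_le_diam_of_mem ?_ hx' hy').trans ?_
  · exact (isBounded_convexHull).2 (t.finite_toSet.image A).isBounded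
  · rw [convexHull_diam]
    refine Metric.diam_le_of_forall_dist_le hM ?_
    rintro _ ⟨a, ha, rfl⟩ _ ⟨b, hb, rfl⟩
    exact hA a ha b hb

/-- An affine map on an element varies along a diameter of the inscribed ball by no more than
between two vertices, which bounds its gradient. -/
theorem norm_grad_sq_le (hm : 0 < m) (hσ : 0 < σ) (hS : IsQuasiUniform σ S) {Z : Vec m → Vec d}
    (hZ : ∀ t ∈ elements S, ∃ A : Vec m →ᵃ[ℝ] Vec d, EqOn Z A (cell t))
    (ht : t ∈ elements S) {M : ℝ} (hM : 0 ≤ M) (hZM : ∀ a ∈ t, ∀ b ∈ t, ‖Z a - Z b‖ ^ 2 ≤ M)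
    {s : Vec m} (hs : s ∈ interior (cell t)) :
    ‖grad Z s‖ ^ 2 ≤ m * (M * (σ / (2 * meshSize S)) ^ 2) := by
  obtain ⟨A, hA⟩ := hZ t ht
  obtain ⟨c, hc, -⟩ := hS.exists_inner_outer_ball hσ ht
  have hh := hS.meshSize_pos hm ht
  set r := meshSize S / σ with hr
  have hr0 : 0 < r := div_pos hh hσ
  have hAM : ∀ a ∈ t, ∀ b ∈ t, dist (A a) (A b) ≤ √M := fun a ha b hb => by
    rw [← hA (subset_cell t ha), ← hA (subset_cell t hb), dist_eq_norm]
    exact Real.le_sqrt_of_sq_le (hZM a ha b hb)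
  have hcol : ∀ j, ‖A.linear (EuclideanSpace.single j 1)‖ ^ 2
      ≤ M * (σ / (2 * meshSize S)) ^ 2 := by
    intro j
    have hmem : ∀ q : ℝ, |q| = r → c + q • EuclideanSpace.single j (1 : ℝ) ∈ cell t :=
      fun q hq => hc (by simp [norm_smul, hq])
    have h1 := dist_le_of_mem_cell A (Real.sqrt_nonneg M) hAM (hmem r (abs_of_pos hr0))
      (hmem (-r) (by rw [abs_neg, abs_of_pos hr0]))
    have h2 : A (c + r • EuclideanSpace.single j (1 : ℝ))
        - A (c + -r • EuclideanSpace.single j (1 : ℝ))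
        = (2 * r) • A.linear (EuclideanSpace.single j 1) := by
      rw [← vsub_eq_sub, ← A.linearMap_vsub, vsub_eq_sub, ← map_smul]
      congr 1
      module
    rw [dist_eq_norm, h2, norm_smul, Real.norm_of_nonneg (by positivity)] at h1
    have h3 : (2 * r * ‖A.linear (EuclideanSpace.single j 1)‖) ^ 2 ≤ M := by
      rw [← Real.sq_sqrt hM]
      exact pow_le_pow_left₀ (by positivity) h1 2
    have h4 : σ / (2 * meshSize S) = (2 * r)⁻¹ := by rw [hr]; field_simp
    rw [h4, inv_pow, ← div_eq_mul_inv, le_div_iff₀ (by positivity)]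
    linarith
  have hgrad : ‖grad Z s‖ ^ 2 = ∑ j, ‖A.linear (EuclideanSpace.single j 1)‖ ^ 2 := by
    rw [grad_congr isOpen_interior (hA.mono interior_subset) hs]
    simp only [EuclideanSpace.norm_sq_eq, Fintype.sum_prod_type, grad,
      (hasFDerivAt_affineMap A s).fderiv]
    exact Finset.sum_comm
  rw [hgrad]
  refine (Finset.sum_le_sum fun j _ => hcol j).trans_eq ?_
  simp

theorem dist_le_maxEdge (hS : IsQuasiUniform σ S) (Y : Vec m → Vec d) (ht : t ∈ elements S)
    {a b : Vec m} (ha : a ∈ t) (hb : b ∈ t) : dist (Y a) (Y b) ≤ maxEdge S Y := by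
  refine le_csSup ?_ ⟨t, ht, a, ha, b, hb, rfl⟩
  have hfin : (⋃ t ∈ elements S,
      (fun q : Vec m × Vec m => dist (Y q.1) (Y q.2)) '' ((t ×ˢ t : Finset _) : Set _)).Finite :=
    hS.finite_elements.biUnion fun t _ => (Finset.finite_toSet _).image _
  refine (hfin.subset ?_).bddAbove
  rintro r ⟨t, ht, a, ha, b, hb, rfl⟩
  exact mem_biUnion ht ⟨(a, b), by simp [ha, hb], rfl⟩

theorem maxEdge_nonneg (S : Mesh m) (Y : Vec m → Vec d) : 0 ≤ maxEdge S Y := by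
  refine Real.sSup_nonneg ?_
  rintro r ⟨t, ht, a, ha, b, hb, rfl⟩
  exact dist_nonneg

theorem ncard_touching_le (hS : IsQuasiUniform σ S) (T : Mesh d) (Y : Vec m → Vec d)
    {K : Finset (Vec d)} (hK : K ∈ elements T) :
    {t | t ∈ elements S ∧ (Y '' cell t ∩ cell K).Nonempty}.ncard ≤ maxTouching T S Y := by
  refine le_csSup ⟨(elements S).ncard, ?_⟩ ⟨K, hK, rfl⟩
  rintro j ⟨K, -, rfl⟩
  exact ncard_le_ncard (fun t ht => ht.1) hS.finite_elements

end PiecewiseAffine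

/-! ### Evaluation of velocities along the structure -/

/-- The gradient of a velocity field along the structure, represented by any piecewise affine `Z`
with the vertex values `v ∘ Y`, is controlled by the gradient of the velocity field in the fluid
domain. On an element `t` of the solid mesh `|∇Z|²` is at most of the order `h_s⁻²` times the squared
variation of `v` between two vertices, which is at most `L h_x` times the sum of the squared
Lipschitz constants of `v` on the fluid elements touched by `t`; by the inverse estimate these are
of the order `h_x⁻ᵈ ∫_K |∇v|²`. In the sum over `t`, of volume at most of the order `h_sᵐ`, each
fluid element `K` occurs at most `C_e` times. -/
theorem exists_normSq_grad_along_le (d m k : ℕ) (hd : 0 < d) (hm : 0 < m) {σ : ℝ} (hσ : 0 < σ) :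
    ∃ C : ℝ, 0 ≤ C ∧ ∀ (T : Mesh d) (S : Mesh m) (v : Vec d → Vec d) (Y Z : Vec m → Vec d),
      IsQuasiUniform σ T → IsQuasiUniform σ S → IsVelocityField T k v → IsPlacement T S Y →
      (∀ t ∈ elements S, ∃ A : Vec m →ᵃ[ℝ] Vec d, EqOn Z A (cell t)) →
      (∀ a ∈ S.vertices, Z a = v (Y a)) →
      normSq S.space (grad Z) ≤ C * meshSize S ^ ((m : ℤ) - 2) * meshSize T ^ (-((d : ℤ) - 1))
        * maxEdge S Y * maxTouching T S Y * normSq (domain T) (grad v) := by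
  classical
  obtain ⟨C, hC, hinv⟩ := exists_norm_sub_le_on_cell d k hd hσ
  set ω := volume.real (Metric.closedBall (0 : Vec m) 1)
  refine ⟨ω * m * (σ / 2) ^ 2 * C, by positivity, fun T S v Y Z hT hS hv hY hZ hZv => ?_⟩
  set I : Finset (Vec d) → ℝ := fun K => normSq (interior (cell K)) (grad v) with hI
  have hI0 : ∀ K, 0 ≤ I K := fun K => integral_nonneg fun x => sq_nonneg _
  have hv0 : 0 ≤ normSq (domain T) (grad v) := integral_nonneg fun x => sq_nonneg _
  have hL0 := maxEdge_nonneg S Y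
  have hhx : 0 ≤ meshSize T := Real.sSup_nonneg (by rintro r ⟨t, ht, rfl⟩; exact Metric.diam_nonneg)
  have hhs : 0 ≤ meshSize S := Real.sSup_nonneg (by rintro r ⟨t, ht, rfl⟩; exact Metric.diam_nonneg)
  rcases (elements S).eq_empty_or_nonempty with hempty | ⟨t₀, ht₀⟩
  · have h0 : normSq S.space (grad Z) = 0 := by
      rw [normSq, hS.space_eq, hempty]
      simp
    rw [h0]
    have := zpow_nonneg hhs ((m : ℤ) - 2)
    have := zpow_nonneg hhx (-((d : ℤ) - 1))
    positivity
  have hhs := hS.meshSize_pos hm ht₀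
  -- The structure lies in the closure of the domain, so that the fluid mesh is not empty either.
  have hhx : 0 < meshSize T := by
    obtain ⟨a, ha⟩ : t₀.Nonempty := Finset.card_pos.1 (by rw [ht₀.2]; omega)
    have h1 := hY.mapsTo (cell_subset_space ht₀ (subset_cell t₀ ha))
    have h2 : Y a ∈ T.space :=
      closure_minimal interior_subset hT.isCompact_space.isClosed h1
    rw [hT.space_eq] at h2
    obtain ⟨K, hK, -⟩ := mem_iUnion₂.1 h2
    exact hT.meshSize_pos hd hK
  let touch : Finset (Vec m) → Finset (Finset (Vec d)) := fun t =>
    hT.finite_elements.toFinset.filter fun K => (Y '' cell t ∩ cell K).Nonempty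
  set M : Finset (Vec m) → ℝ := fun t =>
    maxEdge S Y * (meshSize T * ∑ K ∈ touch t, C * (meshSize T ^ d)⁻¹ * I K) with hMdef
  have hM0 : ∀ t, 0 ≤ M t := fun t => mul_nonneg hL0 (mul_nonneg hhx.le
    (Finset.sum_nonneg fun K _ => mul_nonneg (by positivity) (hI0 K)))
  have hZM : ∀ t ∈ elements S, ∀ a ∈ t, ∀ b ∈ t, ‖Z a - Z b‖ ^ 2 ≤ M t := by
    intro t ht a ha b hb
    rw [hZv a (mem_vertices_of_mem_elements ht ha), hZv b (mem_vertices_of_mem_elements ht hb)]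
    have htouch : ∀ K ∈ elements T, (segment ℝ (Y a) (Y b) ∩ cell K).Nonempty → K ∈ touch t := by
      rintro K hK ⟨x, hx, hxK⟩
      refine Finset.mem_filter.2 ⟨by simpa using hK, x, ?_, hxK⟩
      obtain ⟨A, hA⟩ := hY.affine t ht
      rw [hA (subset_cell t ha), hA (subset_cell t hb), ← image_segment] at hx
      obtain ⟨y, hy, rfl⟩ := hx
      have hyt := (convex_cell t).segment_subset (subset_cell t ha) (subset_cell t hb) hy
      exact ⟨y, hyt, hA hyt⟩
    refine (hv.norm_sub_sq_le hT (hinv T v hT hv) (fun K hK => ?_) htouch).trans ?_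
    · simpa using (Finset.mem_filter.1 hK).1
    · rw [← dist_eq_norm, Finset.sum_congr rfl fun K _ =>
        Real.sq_sqrt (mul_nonneg (by positivity) (hI0 K))]
      exact mul_le_mul_of_nonneg_right (dist_le_maxEdge hS Y ht ha hb) (mul_nonneg hhx.le
        (Finset.sum_nonneg fun K _ => mul_nonneg (by positivity) (hI0 K)))
  -- Each element of the fluid mesh is counted as often as it is touched.
  have hcount : ∑ t ∈ hS.finite_elements.toFinset, ∑ K ∈ touch t, I K
      ≤ maxTouching T S Y * normSq (domain T) (grad v) := by
    rw [hv.normSq_grad_eq_sum hT, Finset.mul_sum]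
    simp only [touch, Finset.sum_filter]
    rw [Finset.sum_comm]
    refine Finset.sum_le_sum fun K hK => ?_
    rw [← Finset.sum_filter, Finset.sum_const, nsmul_eq_mul]
    refine mul_le_mul_of_nonneg_right (Nat.cast_le.2 ?_) (hI0 K)
    refine le_trans (le_of_eq ?_) (ncard_touching_le hS T Y (by simpa using hK))
    rw [← ncard_coe_finset]
    congr 1
    ext t
    simp
  obtain ⟨F, hF⟩ := exists_grad_eq hZ
  have hne : ∀ t ∈ elements S, (interior (cell t)).Nonempty := fun t ht => by
    obtain ⟨c, hc⟩ := hS.inner_ball t ht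
    exact ⟨c, mem_interior.2 ⟨_, Metric.ball_subset_closedBall.trans hc, Metric.isOpen_ball,
      Metric.mem_ball_self (div_pos hhs hσ)⟩⟩
  calc normSq S.space (grad Z)
      = ∑ t ∈ hS.finite_elements.toFinset, volume.real (interior (cell t)) * ‖F t‖ ^ 2 :=
        hS.integral_eq_sum_of_eqOn fun t ht s hs => by rw [(hF t ht s hs).2]
    _ ≤ ∑ t ∈ hS.finite_elements.toFinset,
          (ω * meshSize S ^ m) * (m * (M t * (σ / (2 * meshSize S)) ^ 2)) := by
        refine Finset.sum_le_sum fun t ht => ?_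
        have ht : t ∈ elements S := by simpa using ht
        obtain ⟨s, hs⟩ := hne t ht
        have := norm_grad_sq_le hm hσ hS hZ ht (hM0 t) (hZM t ht) hs
        rw [(hF t ht s hs).2] at this
        exact mul_le_mul (hS.volume_real_interior_cell_le hσ ht) this (sq_nonneg _) (by positivity)
    _ = (ω * m * (σ / 2) ^ 2 * C * (meshSize S ^ m * (meshSize S ^ 2)⁻¹)
          * (meshSize T * (meshSize T ^ d)⁻¹) * maxEdge S Y)
          * ∑ t ∈ hS.finite_elements.toFinset, ∑ K ∈ touch t, I K := by
        rw [Finset.mul_sum]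
        refine Finset.sum_congr rfl fun t _ => ?_
        simp only [hMdef, ← Finset.mul_sum]
        field_simp
    _ ≤ (ω * m * (σ / 2) ^ 2 * C * (meshSize S ^ m * (meshSize S ^ 2)⁻¹)
          * (meshSize T * (meshSize T ^ d)⁻¹) * maxEdge S Y)
          * (maxTouching T S Y * normSq (domain T) (grad v)) :=
        mul_le_mul_of_nonneg_left hcount (by positivity)
    _ = _ := by
        have e1 : meshSize S ^ ((m : ℤ) - 2) = meshSize S ^ m * (meshSize S ^ 2)⁻¹ := by
          rw [zpow_sub₀ hhs.ne', div_eq_mul_inv]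
          norm_cast
        have e2 : meshSize T ^ (-((d : ℤ) - 1)) = meshSize T * (meshSize T ^ d)⁻¹ := by
          rw [neg_sub, zpow_sub₀ hhx.ne', div_eq_mul_inv, zpow_one, zpow_natCast]
        rw [e1, e2]
        ring

/-! ### Energies -/

section Energy

/-- The tangent inequality for a convex energy density, with the tensor at the new gradient `F'`
replaced by the one at the old gradient `F`. -/
theorem energy_sub_le {d m : ℕ} {W : Tensor d m → ℝ} {𝒦 : Set (Tensor d m)} {κ : NNReal}
    (hW : ContDiff ℝ 1 W) (hconv : ConvexOn ℝ univ W) (hlip : LipschitzOnWith κ (piola W) 𝒦)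
    {F F' : Tensor d m} (hF : F ∈ 𝒦) (hF' : F' ∈ 𝒦) :
    W F' - W F ≤ inner ℝ (piola W F) (F' - F) + κ * ‖F' - F‖ ^ 2 := by
  have hdiff : DifferentiableAt ℝ W F' := (hW.differentiable one_ne_zero) F'
  let φ : ℝ → ℝ := W ∘ AffineMap.lineMap F F'
  have hφ : ConvexOn ℝ univ φ := hconv.comp_affineMap (AffineMap.lineMap F F')
  have hφ' : HasDerivAt φ (inner ℝ (piola W F') (F' - F)) 1 := by
    have h1 : HasGradientAt W (piola W F') (AffineMap.lineMap F F' (1 : ℝ)) := by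
      rw [AffineMap.lineMap_apply_one]
      exact hdiff.hasGradientAt
    exact h1.hasFDerivAt.comp_hasDerivAt (1 : ℝ) AffineMap.hasDerivAt_lineMap
  have h1 := hφ.slope_le_of_hasDerivAt (mem_univ 0) (mem_univ 1) zero_lt_one hφ'
  simp only [slope_def_field, φ, Function.comp_apply, AffineMap.lineMap_apply_one,
    AffineMap.lineMap_apply_zero, sub_zero, div_one] at h1
  have h2 : inner ℝ (piola W F' - piola W F) (F' - F) ≤ κ * ‖F' - F‖ ^ 2 := by
    refine (real_inner_le_norm _ _).trans ?_
    rw [sq, ← mul_assoc]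
    refine mul_le_mul_of_nonneg_right ?_ (norm_nonneg _)
    simpa [dist_eq_norm] using hlip.dist_le_mul _ hF' _ hF
  rw [inner_sub_left] at h2
  linarith

/-- The kinetic energy balance `(f - g) · f ≥ (|f|² - |g|²) / 2`, integrated. -/
theorem normSq_sub_normSq_le_ip {n : ℕ} {F : Type*} [NormedAddCommGroup F] [InnerProductSpace ℝ F]
    {K A : Set (Vec n)} (hK : IsCompact K) (hA : A ⊆ K) {f g : Vec n → F} (hf : ContinuousOn f K)
    (hg : ContinuousOn g K) :
    (normSq A f - normSq A g) / 2 ≤ ip A (fun x => f x - g x) f := by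
  have i1 : IntegrableOn (fun x => ‖f x‖ ^ 2) A :=
    ((hf.norm.pow 2).integrableOn_compact hK).mono_set hA
  have i2 : IntegrableOn (fun x => ‖g x‖ ^ 2) A :=
    ((hg.norm.pow 2).integrableOn_compact hK).mono_set hA
  have i3 : IntegrableOn (fun x => inner ℝ (f x - g x) (f x)) A :=
    (((hf.sub hg).inner hf).integrableOn_compact hK).mono_set hA
  rw [normSq, normSq, ip, ← integral_sub i1 i2, ← integral_div]
  refine integral_mono ((i1.sub i2).div_const 2) i3 fun x => ?_
  have h := norm_sub_sq_real (f x) (g x)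
  simp only [inner_sub_left, real_inner_self_eq_norm_sq, real_inner_comm (f x) (g x)]
  nlinarith [sq_nonneg ‖f x - g x‖, real_inner_comm (f x) (g x)]

variable {d m : ℕ} {σ : ℝ} {T : Mesh d} {S : Mesh m}

theorem exists_affineMap_smul_sub {Y Y' : Vec m → Vec d} (hY : IsPlacement T S Y)
    (hY' : IsPlacement T S Y') (c : ℝ) :
    ∀ t ∈ elements S, ∃ A : Vec m →ᵃ[ℝ] Vec d, EqOn (fun s => c • (Y' s - Y s)) A (cell t) := by
  intro t ht
  obtain ⟨A, hA⟩ := hY.affine t ht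
  obtain ⟨A', hA'⟩ := hY'.affine t ht
  exact ⟨c • (A' - A), fun s hs => by simp [hA hs, hA' hs]⟩

/-- The velocity at the vertices, interpolated, is the discrete velocity of the structure. -/
theorem along_eq (hS : IsQuasiUniform σ S) {Y Y' : Vec m → Vec d} (hY : IsPlacement T S Y)
    (hY' : IsPlacement T S Y') {v : Vec d → Vec d} {τ : ℝ}
    (hv : ∀ a ∈ S.vertices, τ⁻¹ • (Y' a - Y a) = v (Y a)) :
    EqOn (along S Y v) (fun s => τ⁻¹ • (Y' s - Y s)) S.space := fun _ hs =>
  interp_eq hS (exists_affineMap_smul_sub hY hY' τ⁻¹) (fun a ha => (hv a ha).symm) hs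

/-- The work of the elastic force accounts for the change of the elastic energy up to an error due
to the explicit treatment of the Piola-Kirchhoff tensor. -/
theorem elasticEnergy_sub_le (hS : IsQuasiUniform σ S) {Y Y' : Vec m → Vec d}
    (hY : IsPlacement T S Y) (hY' : IsPlacement T S Y') {v : Vec d → Vec d} {τ : ℝ} (hτ : 0 < τ)
    (hv : ∀ a ∈ S.vertices, τ⁻¹ • (Y' a - Y a) = v (Y a))
    {W : Tensor d m → ℝ} {𝒦 : Set (Tensor d m)} {κ : NNReal}
    (hW : ContDiff ℝ 1 W) (hconv : ConvexOn ℝ univ W) (hlip : LipschitzOnWith κ (piola W) 𝒦)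
    (hg : ∀ t ∈ elements S, ∀ s ∈ interior (cell t), grad Y s ∈ 𝒦)
    (hg' : ∀ t ∈ elements S, ∀ s ∈ interior (cell t), grad Y' s ∈ 𝒦) :
    1 / τ * (elasticEnergy S W Y' - elasticEnergy S W Y) ≤ -force S W Y v
      + κ * τ * normSq S.space (grad fun s => τ⁻¹ • (Y' s - Y s)) := by
  obtain ⟨F, hF⟩ := exists_grad_eq hY.affine
  obtain ⟨F', hF'⟩ := exists_grad_eq hY'.affine
  have hZ : ∀ t ∈ elements S, ∀ s ∈ interior (cell t),
      grad (fun s => τ⁻¹ • (Y' s - Y s)) s = τ⁻¹ • (F' t - F t) := fun t ht s hs => by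
    rw [grad_smul_sub _ (hF t ht s hs).1 (hF' t ht s hs).1, (hF t ht s hs).2, (hF' t ht s hs).2]
  have halong : ∀ t ∈ elements S, ∀ s ∈ interior (cell t),
      grad (along S Y v) s = τ⁻¹ • (F' t - F t) := fun t ht s hs => by
    rw [← hZ t ht s hs]
    exact grad_congr isOpen_interior ((along_eq hS hY hY' hv).mono
      (interior_subset.trans (cell_subset_space ht))) hs
  have e1 := hS.integral_eq_sum_of_eqOn (g := fun s => W (grad Y s)) (a := fun t => W (F t))
    fun t ht s hs => by simp only [(hF t ht s hs).2]
  have e2 := hS.integral_eq_sum_of_eqOn (g := fun s => W (grad Y' s)) (a := fun t => W (F' t))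
    fun t ht s hs => by simp only [(hF' t ht s hs).2]
  have e3 := hS.integral_eq_sum_of_eqOn
    (g := fun s => inner ℝ (piola W (grad Y s)) (grad (along S Y v) s))
    (a := fun t => inner ℝ (piola W (F t)) (τ⁻¹ • (F' t - F t)))
    fun t ht s hs => by simp only [(hF t ht s hs).2, halong t ht s hs]
  have e4 := hS.integral_eq_sum_of_eqOn
    (g := fun s => ‖grad (fun s => τ⁻¹ • (Y' s - Y s)) s‖ ^ 2)
    (a := fun t => ‖τ⁻¹ • (F' t - F t)‖ ^ 2) fun t ht s hs => by simp only [hZ t ht s hs]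
  rw [elasticEnergy, elasticEnergy, force, ip, normSq, neg_neg, e1, e2, e3, e4,
    ← Finset.sum_sub_distrib, Finset.mul_sum, Finset.mul_sum, ← Finset.sum_add_distrib]
  refine Finset.sum_le_sum fun t ht => ?_
  have ht : t ∈ elements S := by simpa using ht
  rcases (interior (cell t)).eq_empty_or_nonempty with hempty | ⟨s, hs⟩
  · simp [hempty]
  have hFK := hg t ht s hs
  have hFK' := hg' t ht s hs
  rw [(hF t ht s hs).2] at hFK
  rw [(hF' t ht s hs).2] at hFK'
  have h := energy_sub_le hW hconv hlip hFK hFK'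
  have h' := mul_le_mul_of_nonneg_left h (inv_nonneg.2 hτ.le)
  have h'' := mul_le_mul_of_nonneg_left h' (measureReal_nonneg (μ := volume)
    (s := interior (cell t)))
  rw [inner_smul_right, norm_smul, Real.norm_of_nonneg (inv_nonneg.2 hτ.le)]
  calc _ = volume.real (interior (cell t)) * (τ⁻¹ * (W (F' t) - W (F t))) := by ring
    _ ≤ _ := h''
    _ = _ := by field_simp

end Energy

end FEIBM

end

theorem mainTheorem2 (d m k : ℕ) (hd : d = 2 ∨ d = 3) (hm : m = d ∨ m + 1 = d)
    (σ : ℝ) (hσ : 0 < σ) :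
    ∃ C : ℝ, 0 < C ∧
      ∀ (T : FEIBM.Mesh d) (S : FEIBM.Mesh m)
        (V : Submodule ℝ (FEIBM.Vec d → FEIBM.Vec d)) (Q : Submodule ℝ (FEIBM.PressureL2 T))
        (W : FEIBM.Tensor d m → ℝ) (𝒦 : Set (FEIBM.Tensor d m)) (κ : NNReal)
        (ρ δρ ν τ : ℝ) (N : ℕ)
        (u : ℕ → FEIBM.Vec d → FEIBM.Vec d) (p : ℕ → FEIBM.PressureL2 T)
        (X : ℤ → FEIBM.Vec m → FEIBM.Vec d),
        FEIBM.IsQuasiUniform σ T → FEIBM.IsQuasiUniform σ S →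
        FEIBM.IsVelocitySpace T k V → FEIBM.IsPressureSpace T Q →
        ContDiff ℝ 1 W → ConvexOn ℝ Set.univ W →
        Convex ℝ 𝒦 → LipschitzOnWith κ (FEIBM.piola W) 𝒦 →
        0 < ρ → 0 ≤ δρ → 0 < ν → 0 < τ →
        FEIBM.IsSolution T S V Q W ρ δρ ν τ N u p X →
        (∀ n : ℕ, n ≤ N → ∀ t ∈ FEIBM.elements S, ∀ s ∈ interior (FEIBM.cell t),
          FEIBM.grad (X n) s ∈ 𝒦) →
        ∀ n : ℕ, n < N →
          (ρ / (2 * τ) * (FEIBM.normSq (FEIBM.domain T) (u (n + 1))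
                - FEIBM.normSq (FEIBM.domain T) (u n))
              + (ν + FEIBM.artificialViscosity T S κ C τ (X n))
                * FEIBM.normSq (FEIBM.domain T) (FEIBM.grad (u (n + 1)))
              + 1 / τ * (FEIBM.elasticEnergy S W (X (n + 1)) - FEIBM.elasticEnergy S W (X n))
              + 1 / (2 * τ) * δρ * (FEIBM.structureSpeedSq S τ (X n) (X (n + 1))
                - FEIBM.structureSpeedSq S τ (X (n - 1)) (X n)) ≤ 0) ∧
          (∀ c : ℝ, κ * C * FEIBM.maxTouching T S (X n) * c ≤ ν →
            FEIBM.maxEdge S (X n) * τ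
              ≤ c * FEIBM.meshSize T ^ ((d : ℤ) - 1) * FEIBM.meshSize S ^ (2 - (m : ℤ)) →
            FEIBM.totalEnergy T S W ρ δρ τ u X (n + 1)
              ≤ FEIBM.totalEnergy T S W ρ δρ τ u X n) := by
  open FEIBM in
  have hd0 : 0 < d := by omega
  have hm0 : 0 < m := by omega
  obtain ⟨C₀, hC₀, hC⟩ := exists_normSq_grad_along_le d m k hd0 hm0 hσ
  refine ⟨C₀ + 1, by positivity, ?_⟩
  intro T S V Q W 𝒦 κ ρ δρ ν τ N u p X hT hS hV _ hW hconv _ hlip hρ hδρ hν hτ hsol hgrad n hn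
  have hv := hV _ (hsol.velocity_mem (n + 1) hn)
  have hv₀ := hV _ (hsol.velocity_mem n hn.le)
  have hX := hsol.placement_mem n (by omega) (by omega)
  have hX' := hsol.placement_mem (n + 1) (by omega) (by omega)
  have hX₀ := hsol.placement_mem (n - 1) (by omega) (by omega)
  have hmot : ∀ a ∈ S.vertices, τ⁻¹ • (X (n + 1) a - X n a) = u (n + 1) (X n a) := by
    simpa using hsol.motion (n + 1) hn
  have hmot₀ := hsol.motion n hn.le
  have halong := along_eq hS hX hX' hmot
  have halong₀ := along_eq hS hX₀ hX hmot₀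
  have hhx : 0 ≤ meshSize T := Real.sSup_nonneg (by rintro r ⟨t, ht, rfl⟩; exact Metric.diam_nonneg)
  have hhs : 0 ≤ meshSize S := Real.sSup_nonneg (by rintro r ⟨t, ht, rfl⟩; exact Metric.diam_nonneg)
  have hzs := zpow_nonneg hhs ((m : ℤ) - 2)
  have hzx := zpow_nonneg hhx (-((d : ℤ) - 1))
  have hL0 := maxEdge_nonneg S (X n)
  have hG0 : 0 ≤ normSq (domain T) (grad (u (n + 1))) := integral_nonneg fun x => sq_nonneg _
  have hκ0 : (0 : ℝ) ≤ κ := κ.2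
  have henergy : ρ / (2 * τ) * (normSq (domain T) (u (n + 1)) - normSq (domain T) (u n))
      + (ν + artificialViscosity T S κ (C₀ + 1) τ (X n))
        * normSq (domain T) (grad (u (n + 1)))
      + 1 / τ * (elasticEnergy S W (X (n + 1)) - elasticEnergy S W (X n))
      + 1 / (2 * τ) * δρ * (structureSpeedSq S τ (X n) (X (n + 1))
        - structureSpeedSq S τ (X (n - 1)) (X n)) ≤ 0 := by
    -- With the new velocity as test function the convective terms cancel.
    have hmom := hsol.momentum n hn _ (hsol.velocity_mem (n + 1) hn)
    rw [hsol.incompressible n hn _ (hsol.pressure_mem n hn)] at hmom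
    have hfluid := normSq_sub_normSq_le_ip hT.isCompact_space (A := domain T) interior_subset
      hv.continuous.continuousOn hv₀.continuous.continuousOn
    have hfluid' : ip (domain T) (fun x => τ⁻¹ • (u (n + 1) x - u n x)) (u (n + 1))
        = τ⁻¹ * ip (domain T) (fun x => u (n + 1) x - u n x) (u (n + 1)) := by
      simp only [ip, real_inner_smul_left, integral_const_mul]
    have hspeed : ∀ {Y Y' : Vec m → Vec d}, ContinuousOn Y S.space → ContinuousOn Y' S.space →
        ContinuousOn (fun s => τ⁻¹ • (Y' s - Y s)) S.space := fun hY hY' => by fun_prop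
    have hsolid := normSq_sub_normSq_le_ip hS.isCompact_space subset_rfl
      (f := fun s => τ⁻¹ • (X (n + 1) s - X n s)) (g := fun s => τ⁻¹ • (X n s - X (n - 1) s))
      (hspeed hX.continuousOn hX'.continuousOn) (hspeed hX₀.continuousOn hX.continuousOn)
    have hsolid' : ip S.space
        (fun s => τ⁻¹ • (along S (X n) (u (n + 1)) s - along S (X (n - 1)) (u n) s))
        (along S (X n) (u (n + 1)))
        = τ⁻¹ * ip S.space (fun s => τ⁻¹ • (X (n + 1) s - X n s) - τ⁻¹ • (X n s - X (n - 1) s))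
          (fun s => τ⁻¹ • (X (n + 1) s - X n s)) := by
      rw [ip, ip, ← integral_const_mul]
      refine setIntegral_congr_fun hS.isCompact_space.measurableSet fun s hs => ?_
      simp only [halong hs, halong₀ hs, real_inner_smul_left]
    have hkorn := hv.normSq_grad_le_normSq_symGrad hd0 hσ hT
    have hkorn' : ip (domain T) (symGrad (u (n + 1))) (symGrad (u (n + 1)))
        = normSq (domain T) (symGrad (u (n + 1))) := by
      simp only [ip, normSq, real_inner_self_eq_norm_sq]
    have helastic := elasticEnergy_sub_le hS hX hX' hτ hmot hW hconv hlip (hgrad n hn.le)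
      (by exact_mod_cast hgrad (n + 1) hn)
    have hinv := hC T S (u (n + 1)) (X n) _ hT hS hv hX
      (exists_affineMap_smul_sub hX hX' τ⁻¹) hmot
    have hvisc : artificialViscosity T S κ (C₀ + 1) τ (X n)
        * normSq (domain T) (grad (u (n + 1)))
        ≤ -(κ * τ * normSq S.space (grad fun s => τ⁻¹ • (X (n + 1) s - X n s))) := by
      have h1 := mul_le_mul_of_nonneg_left hinv (mul_nonneg hκ0 hτ.le)
      have h2 : 0 ≤ κ * τ * (meshSize S ^ ((m : ℤ) - 2) * meshSize T ^ (-((d : ℤ) - 1))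
          * maxEdge S (X n) * maxTouching T S (X n) * normSq (domain T) (grad (u (n + 1)))) := by
        positivity
      rw [artificialViscosity]
      linarith
    rw [hfluid', hsolid', hkorn', sub_self, zero_div, add_zero, sub_zero] at hmom
    have h1 := mul_le_mul_of_nonneg_left hfluid (div_nonneg hρ.le hτ.le)
    have h2 := mul_le_mul_of_nonneg_left hsolid (div_nonneg hδρ hτ.le)
    have h3 := mul_le_mul_of_nonneg_left hkorn hν.le
    have h4 := mul_nonneg hν.le hG0
    -- In the common form `a / τ * b` the terms match up to linear arithmetic.
    have e1 : ∀ a b : ℝ, a / (2 * τ) * b = a / τ * (b / 2) := fun a b => by field_simp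
    have e2 : ∀ a b : ℝ, 1 / (2 * τ) * a * b = a / τ * (b / 2) := fun a b => by field_simp
    have e3 : ∀ a b : ℝ, a * (τ⁻¹ * b) = a / τ * b := fun a b => by field_simp
    rw [e3, e3, neg_div] at hmom
    rw [e1, e2, structureSpeedSq, structureSpeedSq]
    linarith
  refine ⟨henergy, fun c hc hcfl => ?_⟩
  have hnn : 0 ≤ (ν + artificialViscosity T S κ (C₀ + 1) τ (X n))
      * normSq (domain T) (grad (u (n + 1))) := by
    -- The powers of the mesh sizes cancel only for nonzero mesh sizes, that is, nonempty meshes.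
    rcases (elements T).eq_empty_or_nonempty with hempty | ⟨K, hK⟩
    · have h0 : normSq (domain T) (grad (u (n + 1))) = 0 := by
        rw [hv.normSq_grad_eq_sum hT]
        simp [hempty]
      simp [h0]
    refine mul_nonneg ?_ hG0
    rcases (elements S).eq_empty_or_nonempty with hempty | ⟨t, ht⟩
    · simp [artificialViscosity, maxEdge, hempty, hν.le]
    have hhx := hT.meshSize_pos hd0 hK
    have hhs := hS.meshSize_pos hm0 ht
    have h1 : meshSize S ^ ((m : ℤ) - 2) * meshSize S ^ (2 - (m : ℤ)) = 1 := by
      rw [← zpow_add₀ hhs.ne']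
      simp
    have h2 : meshSize T ^ (-((d : ℤ) - 1)) * meshSize T ^ ((d : ℤ) - 1) = 1 := by
      rw [← zpow_add₀ hhx.ne']
      simp
    have h3 : -artificialViscosity T S κ (C₀ + 1) τ (X n) ≤ ν := by
      calc -artificialViscosity T S κ (C₀ + 1) τ (X n)
          = κ * (C₀ + 1) * maxTouching T S (X n)
            * (meshSize S ^ ((m : ℤ) - 2) * meshSize T ^ (-((d : ℤ) - 1)))
            * (maxEdge S (X n) * τ) := by rw [artificialViscosity]; ring
        _ ≤ κ * (C₀ + 1) * maxTouching T S (X n)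
            * (meshSize S ^ ((m : ℤ) - 2) * meshSize T ^ (-((d : ℤ) - 1)))
            * (c * meshSize T ^ ((d : ℤ) - 1) * meshSize S ^ (2 - (m : ℤ))) :=
          mul_le_mul_of_nonneg_left hcfl (by positivity)
        _ = κ * (C₀ + 1) * maxTouching T S (X n) * c
            * (meshSize S ^ ((m : ℤ) - 2) * meshSize S ^ (2 - (m : ℤ)))
            * (meshSize T ^ (-((d : ℤ) - 1)) * meshSize T ^ ((d : ℤ) - 1)) := by ring
        _ ≤ ν := by rw [h1, h2, mul_one, mul_one]; exact hc
    linarith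
  have hcast : ((n + 1 : ℕ) : ℤ) - 1 = n := by push_cast; ring
  simp only [totalEnergy, hcast]
  push_cast
  have h : τ * (ρ / (2 * τ) * (normSq (domain T) (u (n + 1)) - normSq (domain T) (u n))
      + 1 / τ * (elasticEnergy S W (X (n + 1)) - elasticEnergy S W (X n))
      + 1 / (2 * τ) * δρ * (structureSpeedSq S τ (X n) (X (n + 1))
        - structureSpeedSq S τ (X (n - 1)) (X n))) ≤ 0 :=
    mul_nonpos_of_nonneg_of_nonpos hτ.le (by linarith)
  have e : ∀ a b c : ℝ, τ * (ρ / (2 * τ) * a + 1 / τ * b + 1 / (2 * τ) * δρ * c)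
      = ρ / 2 * a + b + δρ / 2 * c := fun a b c => by field_simp
  rw [e] at h
  linarith
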